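/- Let $K$ be a field such that for every finite extension $L$ of $K$ and every natural number $n>0$ the index $[L^*:(L^*)^n]$ of the subgroup of $n$-th powers in the multiplicative group of $L$ is finite and, if $\operatorname{char}(K)=p>0$ and $f\colon L\to L$ is given by $f(x)=x^p-x$, the index $[L^+:f[L]]$ in the additive group of $L$ is also finite. Then at least one of the following holds: (1) there is a non-trivial definable valuation on $K$, i.e. a non-trivial valuation $v$ on $K$ whose valuation ring $\mathcal{O}_v=\{x\in K: v(x)\ge 0\}$ is a subset of $K$ that is first-order definable, with parameters from $K$, in the language of rings; (2) every non-trivial valuation $v$ on $K$ has divisible value group and, if moreover $\operatorname{char}(K)>0$, its residue field is algebraically closed. Here a valuation on $K$ is a surjective map $v\colon K\to\Gamma\cup\{\infty\}$ onto a (linearly) ordered abelian group $\Gamma$, its value group, together with $\infty>\Gamma$, satisfying $v(x)=\infty\iff x=0$, $v(xy)=v(x)+v(y)$ and $v(x+y)\ge\min\{v(x),v(y)\}$; it is non-trivial if $\Gamma\neq\{0\}$. -/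

import Mathlib

universe u w

/-- The additive map `f(x) = x ^ p - x` on a field `L` of prime characteristic `p`. -/
noncomputable def artinSchreierHom (L : Type*) [Field L] (p : ℕ) [Fact p.Prime] [CharP L p] :
    L →+ L where
  toFun x := x ^ p - x
  map_zero' := by simp [(Fact.out : p.Prime).ne_zero]
  map_add' x y := by rw [add_pow_char]; ring

/-- The finiteness condition on the single field `L`: for every `n > 0` the subgroup of `n`-th
powers has finite index in `Lˣ`, and, if `L` has characteristic `p > 0`, the image of
`x ↦ x ^ p - x` has finite index in the additive group of `L`. -/
def FinitePowerIndices (L : Type*) [Field L] : Prop :=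
  (∀ n : ℕ, 0 < n → (powMonoidHom n : Lˣ →* Lˣ).range.FiniteIndex) ∧
  (∀ (p : ℕ) [Fact p.Prime] [CharP L p], (artinSchreierHom L p).range.FiniteIndex)

/-- A valuation `v` on a field `K` (written multiplicatively, so that the valuation ring is
`{x | v x ≤ 1}`) is definable if its valuation ring is first-order definable, with parameters
from `K`, in the pure field `K`, i.e. in the language of rings. -/
def IsDefinableValuation {K : Type*} [Field K] {Γ₀ : Type*} [LinearOrderedCommGroupWithZero Γ₀]
    (v : Valuation K Γ₀) : Prop :=
  letI := FirstOrder.Ring.compatibleRingOfRing K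
  (Set.univ : Set K).Definable₁ FirstOrder.Language.ring {x : K | v x ≤ 1}

/-! Throughout, `M` denotes the maximal ideal `A.nonunits` of a valuation ring `A`. A defect of a
nontrivial `A` on a finite extension `L` of `K` produces a proper definable subgroup. If some value
is not an `n`-th power in the value group, the `n`-th powers and the units of `A` generate a proper
subgroup of `Lˣ`. In characteristic `p`, if the residue field lacks a `q`-th root for a prime `q ≠
p`, the `q`-th powers and `1 + M` do so; if it lacks an Artin–Schreier root, the image of `y ^ p -
y` together with `M` generates a proper additive subgroup. By the finiteness hypothesis each of
these is a finite union of cosets of a definable subgroup.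

A definable valuation ring is then extracted from the subgroup. When it contains all units of `A`
(`exists_definable_of_units_subset`) or all of `A` (`exists_definable_of_subset_addSubgroup`), a
formula defines a nontrivial coarsening. When only `1 + M` or `M` is known to lie in it, Zorn's
lemma shrinks `A` to a minimal ring with this property. Either the first situation arises or `A`
itself is definable (`exists_definable_of_minimal`): failure of the defining formula would build a
smaller ring with the same property, against minimality.

Coordinates interpret `L` in `K`, and a nontrivial valuation ring of `L` restricts to a nontrivial
one of `K`. So if `K` has no definable nontrivial valuation, no defect occurs over any finite
extension. Taking `L = K` gives divisible value groups. In characteristic `p`, each finite extension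
of the residue field is the residue field of a finite extension of `K`
(`ValuationSubring.exists_extension_residueField`), so all of them have the required roots. By
Artin–Schreier and Kummer theory none has a Galois extension of prime degree; being perfect, the
residue field is algebraically closed. -/

open FirstOrder Language

/-! ### Definability with parameters in a field -/

/-- A function `(α → K) → K` given by a term in the language of rings with parameters from `K`. -/
def IsRingTermFun {K : Type*} [Field K] {α : Type*} (f : (α → K) → K) : Prop :=
  letI := FirstOrder.Ring.compatibleRingOfRing K
  ∃ t : Language.ring.Term (↥(Set.univ : Set K) ⊕ α),
    ∀ c : α → K, t.realize (Sum.elim (↑) c) = f c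

namespace IsRingTermFun

variable {K : Type*} [Field K] {α : Type*} {f g : (α → K) → K}

theorem const (a : K) : IsRingTermFun (fun _ : α → K => a) :=
  ⟨Term.var (Sum.inl ⟨a, trivial⟩), fun _ => rfl⟩

theorem proj (i : α) : IsRingTermFun (fun c : α → K => c i) :=
  ⟨Term.var (Sum.inr i), fun _ => rfl⟩

theorem add (hf : IsRingTermFun f) (hg : IsRingTermFun g) : IsRingTermFun (fun c => f c + g c) := by
  obtain ⟨s, hs⟩ := hf
  obtain ⟨t, ht⟩ := hg
  let _ := FirstOrder.Ring.compatibleRingOfRing K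
  exact ⟨s + t, fun c => by rw [FirstOrder.Ring.realize_add, hs, ht]⟩

theorem mul (hf : IsRingTermFun f) (hg : IsRingTermFun g) : IsRingTermFun (fun c => f c * g c) := by
  obtain ⟨s, hs⟩ := hf
  obtain ⟨t, ht⟩ := hg
  let _ := FirstOrder.Ring.compatibleRingOfRing K
  exact ⟨s * t, fun c => by rw [FirstOrder.Ring.realize_mul, hs, ht]⟩

theorem sum {ι : Type*} (s : Finset ι) {F : ι → (α → K) → K} (h : ∀ i, IsRingTermFun (F i)) :
    IsRingTermFun (fun c => ∑ i ∈ s, F i c) := by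
  classical
  induction s using Finset.induction_on with
  | empty => simpa using const (α := α) (0 : K)
  | insert i s hi ih => simpa [Finset.sum_insert hi] using (h i).add ih

end IsRingTermFun

/-- A predicate on `α → K` is definable with parameters in the field `K`. -/
def FieldDefinable {K : Type*} [Field K] {α : Type*} (φ : (α → K) → Prop) : Prop :=
  letI := FirstOrder.Ring.compatibleRingOfRing K
  (Set.univ : Set K).Definable Language.ring {v | φ v}

namespace FieldDefinable

variable {K : Type*} [Field K] {α β : Type*}

theorem eq {f g : (α → K) → K} (hf : IsRingTermFun f) (hg : IsRingTermFun g) :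
    FieldDefinable (fun v => f v = g v) := by
  obtain ⟨s, hs⟩ := hf
  obtain ⟨t, ht⟩ := hg
  let _ := FirstOrder.Ring.compatibleRingOfRing K
  refine Set.definable_iff_exists_formula_sum.2 ⟨s.equal t, ?_⟩
  ext v
  simp [Formula.realize_equal, hs, ht]

theorem and {φ ψ : (α → K) → Prop} (h : FieldDefinable φ) (h' : FieldDefinable ψ) :
    FieldDefinable (fun v => φ v ∧ ψ v) :=
  let _ := FirstOrder.Ring.compatibleRingOfRing K
  Set.Definable.inter h h'

theorem not {φ : (α → K) → Prop} (h : FieldDefinable φ) : FieldDefinable (fun v => ¬ φ v) :=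
  let _ := FirstOrder.Ring.compatibleRingOfRing K
  Set.Definable.compl h

theorem comp {φ : (β → K) → Prop} (h : FieldDefinable φ) {f : β → (α → K) → K}
    (hf : ∀ i, IsRingTermFun (f i)) : FieldDefinable (fun v => φ (fun i => f i v)) := by
  let _ := FirstOrder.Ring.compatibleRingOfRing K
  obtain ⟨θ, hθ⟩ := Set.definable_iff_exists_formula_sum.1 h
  choose t ht using hf
  refine Set.definable_iff_exists_formula_sum.2
    ⟨BoundedFormula.subst θ (Sum.elim (fun a => Term.var (Sum.inl a)) t), ?_⟩
  ext v
  have h1 : φ (fun i => f i v) ↔ θ.Realize (Sum.elim (↑) fun i => f i v) := by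
    have := congrArg (fun s => (fun i => f i v) ∈ s) hθ
    exact iff_of_eq this
  change φ (fun i => f i v) ↔ _
  rw [h1]
  change _ ↔ BoundedFormula.Realize _ _ _
  rw [BoundedFormula.realize_subst]
  refine iff_of_eq (congrArg (fun w => BoundedFormula.Realize θ w default) ?_)
  funext i
  rcases i with i | i
  · rfl
  · exact (ht i v).symm

theorem exists_tuple [Finite β] {φ : (α → K) → (β → K) → Prop}
    (h : FieldDefinable (fun w : α ⊕ β → K => φ (fun i => w (Sum.inl i)) (fun j => w (Sum.inr j)))) :
    FieldDefinable (fun v => ∃ u, φ v u) :=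
  let _ := FirstOrder.Ring.compatibleRingOfRing K
  Set.Definable.exists_of_finite
    (S := {w : α ⊕ β → K | φ (fun i => w (Sum.inl i)) (fun j => w (Sum.inr j))}) h

end FieldDefinable

/-! ### Interpreting a finite extension in the base field -/

section Coordinates

variable (K : Type*) {L : Type*} [Field K] [Field L] [Algebra K L] [FiniteDimensional K L]
  {α β : Type*}

/-- The tuple of elements of `L` with given coordinates over `K`. -/
noncomputable def ofCoords (c : α × Fin (Module.finrank K L) → K) : α → L :=
  fun i => ∑ j, c (i, j) • Module.finBasis K L j

/-- The coordinates over `K` of a tuple of elements of `L`. -/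
noncomputable def toCoords (v : α → L) : α × Fin (Module.finrank K L) → K :=
  fun i => (Module.finBasis K L).repr (v i.1) i.2

theorem ofCoords_toCoords (v : α → L) : ofCoords K (toCoords K v) = v := by
  funext i
  exact (Module.finBasis K L).sum_repr (v i)

/-- A function on tuples in `L` whose coordinates over `K` are given by ring terms over `K`. -/
def IsCoordTermFun (f : (α → L) → L) : Prop :=
  ∀ j, IsRingTermFun (fun c => (Module.finBasis K L).repr (f (ofCoords K c)) j)

/-- A predicate on tuples in `L` which is definable in `K` when tuples in `L` are replaced by
their coordinates over `K`. -/
def CoordDefinable (φ : (α → L) → Prop) : Prop :=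
  FieldDefinable (fun c => φ (ofCoords K c))

variable {K}

namespace IsCoordTermFun

variable {f g : (α → L) → L}

theorem const (a : L) : IsCoordTermFun K (fun _ : α → L => a) :=
  fun _ => IsRingTermFun.const _

theorem proj (i : α) : IsCoordTermFun K (fun v : α → L => v i) := by
  intro j
  simp only [ofCoords, map_sum, map_smul, Module.Basis.repr_self, Finsupp.coe_finsetSum,
    Finset.sum_apply, Finsupp.smul_apply, smul_eq_mul]
  exact IsRingTermFun.sum _ fun k => (IsRingTermFun.proj _).mul (IsRingTermFun.const _)

theorem add (hf : IsCoordTermFun K f) (hg : IsCoordTermFun K g) :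
    IsCoordTermFun K (fun v => f v + g v) := by
  intro j
  simpa using (hf j).add (hg j)

theorem mul (hf : IsCoordTermFun K f) (hg : IsCoordTermFun K g) :
    IsCoordTermFun K (fun v => f v * g v) := by
  intro j
  -- Multiplication is bilinear in the coordinates; the structure constants of the basis enter as
  -- parameters.
  have key : ∀ x y : L, (Module.finBasis K L).repr (x * y) j =
      ∑ i, ∑ k, (Module.finBasis K L).repr x i * (Module.finBasis K L).repr y k *
        (Module.finBasis K L).repr (Module.finBasis K L i * Module.finBasis K L k) j := by
    intro x y
    conv_lhs => rw [← (Module.finBasis K L).sum_repr x, ← (Module.finBasis K L).sum_repr y,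
      Finset.sum_mul_sum]
    simp only [smul_mul_smul_comm, map_sum, map_smul, Finsupp.coe_finsetSum, Finset.sum_apply,
      Finsupp.smul_apply, smul_eq_mul]
  refine (congrArg IsRingTermFun (funext fun c => key _ _)).mpr ?_
  exact IsRingTermFun.sum _ fun i => IsRingTermFun.sum _ fun k =>
    ((hf i).mul (hg k)).mul (IsRingTermFun.const _)

theorem neg (hf : IsCoordTermFun K f) : IsCoordTermFun K (fun v => - f v) := by
  simpa using (const (-1 : L)).mul hf

theorem sub (hf : IsCoordTermFun K f) (hg : IsCoordTermFun K g) :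
    IsCoordTermFun K (fun v => f v - g v) := by
  simpa [sub_eq_add_neg] using hf.add hg.neg

theorem pow (hf : IsCoordTermFun K f) (n : ℕ) : IsCoordTermFun K (fun v => f v ^ n) := by
  induction n with
  | zero => simpa using const (1 : L)
  | succ n ih => simpa [pow_succ] using ih.mul hf

end IsCoordTermFun

namespace CoordDefinable

variable {φ ψ : (α → L) → Prop} {f g : (α → L) → L}

theorem and (h : CoordDefinable K φ) (h' : CoordDefinable K ψ) :
    CoordDefinable K (fun v => φ v ∧ ψ v) :=
  FieldDefinable.and h h'

theorem not (h : CoordDefinable K φ) : CoordDefinable K (fun v => ¬ φ v) :=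
  FieldDefinable.not h

theorem or (h : CoordDefinable K φ) (h' : CoordDefinable K ψ) :
    CoordDefinable K (fun v => φ v ∨ ψ v) := by
  simpa only [not_and_or, not_not] using (h.not.and h'.not).not

theorem imp (h : CoordDefinable K φ) (h' : CoordDefinable K ψ) :
    CoordDefinable K (fun v => φ v → ψ v) := by
  simpa only [imp_iff_not_or] using h.not.or h'

theorem eq (hf : IsCoordTermFun K f) (hg : IsCoordTermFun K g) :
    CoordDefinable K (fun v => f v = g v) := by
  have key : ∀ v, f v = g v ↔ ¬ ∃ j, ¬ (Module.finBasis K L).repr (f v) j =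
      (Module.finBasis K L).repr (g v) j := by
    intro v
    simp only [not_exists, not_not]
    rw [← DFunLike.ext_iff, (Module.finBasis K L).repr.injective.eq_iff]
  have h2 : ∀ j, FieldDefinable (fun c : α × Fin (Module.finrank K L) → K =>
      (Module.finBasis K L).repr (f (ofCoords K c)) j =
      (Module.finBasis K L).repr (g (ofCoords K c)) j) := fun j => FieldDefinable.eq (hf j) (hg j)
  let _ := FirstOrder.Ring.compatibleRingOfRing K
  have h3 := Set.definable_iInter_of_finite h2
  unfold CoordDefinable FieldDefinable
  convert h3 using 1
  ext c
  simp [key]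

theorem comp {n : Type*} {θ : (n → L) → Prop} (h : CoordDefinable K θ) {F : n → (α → L) → L}
    (hF : ∀ i, IsCoordTermFun K (F i)) : CoordDefinable K (fun v => θ (fun i => F i v)) := by
  have := FieldDefinable.comp h
    (f := fun i c => (Module.finBasis K L).repr (F i.1 (ofCoords K c)) i.2) (fun i => hF i.1 i.2)
  unfold CoordDefinable
  convert this using 3 with c
  exact (ofCoords_toCoords K (fun i => F i (ofCoords K c))).symm

/-- One quantifier over `L` becomes a tuple of quantifiers over `K`. The bound variable takes index
`0` and the free ones are shifted by `Fin.succ`, so formulas below read like de Bruijn terms. -/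
theorem ex {n : ℕ} {θ : (Fin n → L) → L → Prop}
    (h : CoordDefinable K (fun u : Fin (n + 1) → L => θ (Fin.tail u) (u 0))) :
    CoordDefinable K (fun v => ∃ x, θ v x) := by
  have h2 : FieldDefinable (fun c : Fin n × Fin (Module.finrank K L) → K =>
      ∃ e : Fin 1 × Fin (Module.finrank K L) → K, θ (ofCoords K c) (ofCoords K e 0)) := by
    refine FieldDefinable.exists_tuple ?_
    refine FieldDefinable.comp h (f := fun i w => (Fin.cases (motive := fun _ => K)
      (w (Sum.inr (0, i.2))) (fun k => w (Sum.inl (k, i.2))) i.1)) ?_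
    rintro ⟨i, j⟩
    refine Fin.cases ?_ (fun k => ?_) i
    · exact IsRingTermFun.proj _
    · exact IsRingTermFun.proj _
  unfold CoordDefinable
  convert h2 using 3 with c
  constructor
  · rintro ⟨x, hx⟩
    refine ⟨toCoords K (fun _ => x), ?_⟩
    rwa [ofCoords_toCoords]
  · rintro ⟨e, he⟩
    exact ⟨_, he⟩

theorem all {n : ℕ} {θ : (Fin n → L) → L → Prop}
    (h : CoordDefinable K (fun u : Fin (n + 1) → L => θ (Fin.tail u) (u 0))) :
    CoordDefinable K (fun v => ∀ x, θ v x) := by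
  simpa only [not_exists, not_not] using (ex (θ := fun v x => ¬ θ v x) h.not).not

theorem finite_ex {ι : Type*} [Finite ι] {θ : ι → (α → L) → Prop}
    (h : ∀ i, CoordDefinable K (θ i)) : CoordDefinable K (fun v => ∃ i, θ i v) := by
  let _ := FirstOrder.Ring.compatibleRingOfRing K
  have h3 := Set.definable_iUnion_of_finite h
  unfold CoordDefinable FieldDefinable
  convert h3 using 1
  ext c
  simp

end CoordDefinable

variable (K) in
/-- A subset of `L` which is definable in `K` in coordinates. -/
def CoordDefinableSet (S : Set L) : Prop :=
  CoordDefinable K (fun v : Fin 1 → L => v 0 ∈ S)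

namespace CoordDefinableSet

theorem mem {S : Set L} (h : CoordDefinableSet K S) {f : (α → L) → L} (hf : IsCoordTermFun K f) :
    CoordDefinable K (fun v => f v ∈ S) :=
  CoordDefinable.comp h (F := fun _ => f) (fun _ => hf)

theorem add_mul_self {S : Set L} (h : CoordDefinableSet K S) :
    CoordDefinableSet K {x | ∃ a ∈ S, ∃ b ∈ S, ∃ c ∈ S, x = a + b * c} := by
  have : CoordDefinable K (fun v : Fin 1 → L => ∃ a, a ∈ S ∧ ∃ b, b ∈ S ∧ ∃ c, c ∈ S ∧
      v 0 = a + b * c) := by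
    refine .ex (.and (h.mem (.proj _)) (.ex (.and (h.mem (.proj _)) (.ex (.and (h.mem (.proj _))
      (.eq (.proj (Fin.succ (Fin.succ (Fin.succ 0)))) (.add (.proj (Fin.succ (Fin.succ 0)))
        (.mul (.proj (Fin.succ 0)) (.proj 0)))))))))
  exact this

end CoordDefinableSet

end Coordinates

/-! ### Maximal ideals and units of valuation rings -/

section ValuationSubringLemmas

variable {L : Type*} [Field L]

namespace ValuationSubring

variable (A : ValuationSubring L) {x y : L}

theorem mul_mem_nonunits (hx : x ∈ A) (hy : y ∈ A.nonunits) : x * y ∈ A.nonunits := by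
  rw [mem_nonunits_iff, map_mul]
  exact mul_lt_one_of_nonneg_of_lt_one_right ((A.valuation_le_one_iff x).2 hx) zero_le
    (A.mem_nonunits_iff.1 hy)

theorem mem_of_mem_nonunits (hx : x ∈ A.nonunits) : x ∈ A :=
  A.nonunits_subset hx

theorem one_notMem_nonunits : (1 : L) ∉ A.nonunits := by
  simp [mem_nonunits_iff]

theorem inv_mem_nonunits_of_notMem (hx : x ∉ A) : x⁻¹ ∈ A.nonunits :=
  A.inv_mem_nonunits_iff.2 (Or.inr hx)

theorem inv_mem_of_notMem_nonunits (hx : x ∉ A.nonunits) : x⁻¹ ∈ A := by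
  by_contra h
  exact hx (by simpa using A.inv_mem_nonunits_of_notMem h)

theorem inv_notMem_of_mem_nonunits (hx : x ∈ A.nonunits) (h0 : x ≠ 0) : x⁻¹ ∉ A :=
  (A.mem_nonunits_iff_or.1 hx).resolve_left h0

theorem one_add_mem_of_mem_nonunits (hx : x ∈ A.nonunits) : 1 + x ∈ A :=
  A.add_mem _ _ A.one_mem (A.mem_of_mem_nonunits hx)

theorem one_add_notMem_nonunits (hx : x ∈ A.nonunits) : 1 + x ∉ A.nonunits := fun h =>
  A.one_notMem_nonunits (by simpa using sub_mem h hx)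

theorem inv_one_add_mem (hx : x ∈ A.nonunits) : (1 + x)⁻¹ ∈ A :=
  A.inv_mem_of_notMem_nonunits (A.one_add_notMem_nonunits hx)

theorem one_add_ne_zero (hx : x ∈ A.nonunits) : 1 + x ≠ 0 := fun h =>
  A.one_add_notMem_nonunits hx (h ▸ A.nonunits.zero_mem)

theorem pow_mem (hx : x ∈ A) (n : ℕ) : x ^ n ∈ A :=
  _root_.pow_mem hx n

theorem mem_of_pow_mem {n : ℕ} (hn : n ≠ 0) (hx : x ^ n ∈ A) : x ∈ A := by
  rw [← valuation_le_one_iff, map_pow] at hx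
  rw [← valuation_le_one_iff]
  exact (pow_le_one_iff hn).1 hx

theorem mem_nonunits_of_pow_mem {n : ℕ} (hn : n ≠ 0) (hx : x ^ n ∈ A.nonunits) :
    x ∈ A.nonunits := by
  rw [mem_nonunits_iff, map_pow] at hx
  rw [mem_nonunits_iff]
  exact (pow_lt_one_iff hn).1 hx

theorem exists_notMem_of_ne_top {A : ValuationSubring L} (hA : A ≠ ⊤) : ∃ x, x ∉ A := by
  by_contra! h
  exact hA (ValuationSubring.ext _ _ fun x => ⟨fun _ => trivial, fun _ => h x⟩)

theorem ne_top_of_notMem {A : ValuationSubring L} (hx : x ∉ A) : A ≠ ⊤ := fun h =>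
  hx (h ▸ mem_top x)

end ValuationSubring

end ValuationSubringLemmas

/-! ### Multiplicative subgroups of finite index and the rings they define -/

section Subgroups

variable {K L : Type*} [Field K] [Field L] [Algebra K L] [FiniteDimensional K L]

/-- A subset of a field which is a subgroup of the multiplicative group. -/
structure IsMulSubgroup (S : Set L) : Prop where
  one_mem : 1 ∈ S
  mul_mem : ∀ {x y}, x ∈ S → y ∈ S → x * y ∈ S
  inv_mem : ∀ {x}, x ∈ S → x⁻¹ ∈ S
  zero_notMem : (0 : L) ∉ S

namespace IsMulSubgroup

variable {S : Set L} {x y : L}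

theorem ne_zero (hS : IsMulSubgroup S) (hx : x ∈ S) : x ≠ 0 := fun h => hS.zero_notMem (h ▸ hx)

theorem inv_mem_iff (hS : IsMulSubgroup S) : x⁻¹ ∈ S ↔ x ∈ S :=
  ⟨fun h => by simpa using hS.inv_mem h, hS.inv_mem⟩

theorem mul_mem_iff_right (hS : IsMulSubgroup S) (hx : x ∈ S) : x * y ∈ S ↔ y ∈ S :=
  ⟨fun h => by simpa [hS.ne_zero hx] using hS.mul_mem (hS.inv_mem hx) h, hS.mul_mem hx⟩

theorem mul_mem_iff_left (hS : IsMulSubgroup S) (hy : y ∈ S) : x * y ∈ S ↔ x ∈ S := by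
  rw [mul_comm, hS.mul_mem_iff_right hy]

end IsMulSubgroup

theorem Subgroup.isMulSubgroup_image (T : Subgroup Lˣ) :
    IsMulSubgroup ((↑) '' (T : Set Lˣ) : Set L) where
  one_mem := ⟨1, T.one_mem, rfl⟩
  mul_mem := by
    rintro _ _ ⟨x, hx, rfl⟩ ⟨y, hy, rfl⟩
    exact ⟨x * y, T.mul_mem hx hy, by simp⟩
  inv_mem := by
    rintro _ ⟨x, hx, rfl⟩
    exact ⟨x⁻¹, T.inv_mem hx, by simp⟩
  zero_notMem := by
    rintro ⟨x, -, hx⟩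
    exact x.ne_zero hx

/-- `T` is a union of finitely many cosets of the `n`-th powers, and the coset representatives serve
as parameters. -/
theorem CoordDefinableSet.of_powers_le {n : ℕ}
    (hfin : (powMonoidHom n : Lˣ →* Lˣ).range.FiniteIndex) {T : Subgroup Lˣ}
    (hT : (powMonoidHom n : Lˣ →* Lˣ).range ≤ T) :
    CoordDefinableSet K ((↑) '' (T : Set Lˣ) : Set L) := by
  set H := (powMonoidHom n : Lˣ →* Lˣ).range
  have : Finite (Lˣ ⧸ H) := inferInstance
  have key : ∀ x : L, x ∈ ((↑) '' (T : Set Lˣ) : Set L) ↔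
      ∃ q : {q : Lˣ ⧸ H // q.out ∈ T}, ∃ y : L, ¬ y = 0 ∧ x = (q.1.out : Lˣ) * y ^ n := by
    intro x
    constructor
    · rintro ⟨u, hu, rfl⟩
      have h1 : ((u : Lˣ ⧸ H).out)⁻¹ * u ∈ H := QuotientGroup.eq.1 (Quotient.out_eq' _)
      refine ⟨⟨(u : Lˣ ⧸ H), ?_⟩, ?_⟩
      · have := T.mul_mem hu (T.inv_mem (hT h1))
        simpa using this
      · obtain ⟨y, hy⟩ := h1
        refine ⟨y, y.ne_zero, ?_⟩
        have h3 : (u : Lˣ ⧸ H).out * y ^ n = u := by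
          rw [powMonoidHom_apply] at hy
          rw [hy, mul_inv_cancel_left]
        rw [← Units.val_pow_eq_pow_val, ← Units.val_mul, h3]
    · rintro ⟨q, y, hy, rfl⟩
      refine ⟨q.1.out * (Units.mk0 y hy) ^ n, T.mul_mem q.2 (hT ⟨Units.mk0 y hy, rfl⟩), by simp⟩
  unfold CoordDefinableSet
  simp only [key]
  exact .finite_ex fun q => .ex (.and (.not (.eq (.proj 0) (.const 0)))
    (.eq (.proj (Fin.succ 0)) (.mul (.const _) (.pow (.proj 0) n))))

theorem CoordDefinableSet.of_artinSchreier_le {p : ℕ} [Fact p.Prime] [CharP L p]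
    (hfin : (artinSchreierHom L p).range.FiniteIndex) {T : AddSubgroup L}
    (hT : (artinSchreierHom L p).range ≤ T) : CoordDefinableSet K (T : Set L) := by
  set H := (artinSchreierHom L p).range
  have : Finite (L ⧸ H) := inferInstance
  have key : ∀ x : L, x ∈ (T : Set L) ↔
      ∃ q : {q : L ⧸ H // q.out ∈ T}, ∃ y : L, x = q.1.out + (y ^ p - y) := by
    intro x
    constructor
    · intro hx
      have h1 : -((x : L ⧸ H).out) + x ∈ H := QuotientAddGroup.eq.1 (Quotient.out_eq' _)
      refine ⟨⟨(x : L ⧸ H), ?_⟩, ?_⟩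
      · have := T.add_mem hx (T.neg_mem (hT h1))
        simpa using this
      · obtain ⟨y, hy⟩ := h1
        refine ⟨y, ?_⟩
        have hy : y ^ p - y = _ := hy
        rw [hy, add_neg_cancel_left]
    · rintro ⟨q, y, rfl⟩
      exact T.add_mem q.2 (hT ⟨y, rfl⟩)
  unfold CoordDefinableSet
  simp only [key]
  exact .finite_ex fun q => .ex (.eq (.proj (Fin.succ 0)) (.add (.const _)
    (.sub (.pow (.proj 0) p) (.proj 0))))

/-- `A` itself need not be definable, but the part `E` of its maximal ideal lying off `S` and off
`0` is. The ring wanted is the coarsening of `A` formed by the `x` with `x * E` inside the maximal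
ideal of `A`. -/
theorem exists_definable_of_units_subset (A : ValuationSubring L) {S : Set L}
    (hS : IsMulSubgroup S) (hdef : CoordDefinableSet K S)
    (hA : ∀ x ∈ A, x ∉ A.nonunits → x ∈ S) (hne : ∃ z, z ≠ 0 ∧ z ∉ S) :
    ∃ R : ValuationSubring L, R ≠ ⊤ ∧ CoordDefinableSet K (R : Set L) := by
  let E : Set L := {y | y ≠ 0 ∧ y ∉ S ∧ y ∈ A.nonunits}
  have mem_nonunits : ∀ y ∈ A, y ∉ S → y ∈ A.nonunits := fun y hy h => by
    by_contra h'
    exact h (hA y hy h')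
  -- Off `S` there are no units of `A`. If `y` is outside `A`, then `1 + y = y * (1 + y⁻¹)` with
  -- second factor a unit, so `1 + y` stays outside `S` along with `y`.
  have hE : ∀ y, y ∈ E ↔ y ≠ 0 ∧ y ∉ S ∧ 1 + y ∈ S := by
    intro y
    refine and_congr_right fun h0 => and_congr_right fun h1 => ⟨fun h => ?_, fun h => ?_⟩
    · exact hA _ (A.one_add_mem_of_mem_nonunits h) (A.one_add_notMem_nonunits h)
    · by_contra h2
      have h3 : y ∉ A := fun h => h2 (mem_nonunits y h h1)
      have h4 := A.inv_mem_nonunits_of_notMem h3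
      have h5 : 1 + y⁻¹ ∈ S := hA _ (A.one_add_mem_of_mem_nonunits h4) (A.one_add_notMem_nonunits h4)
      have h6 : 1 + y = y * (1 + y⁻¹) := by field_simp; ring
      rw [h6, hS.mul_mem_iff_left h5] at h
      exact h1 h
  have notMem_of : ∀ x, (∀ y ∈ E, x * y ∈ A.nonunits) → x ∉ S → x ∈ A := by
    intro x hx h1
    by_contra h2
    have h0 : x ≠ 0 := fun h => h2 (h ▸ A.zero_mem)
    have := hx x⁻¹ ⟨inv_ne_zero h0, fun h => h1 (hS.inv_mem_iff.1 h),
      A.inv_mem_nonunits_of_notMem h2⟩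
    rw [mul_inv_cancel₀ h0] at this
    exact A.one_notMem_nonunits this
  let R₀ : Subring L :=
    { carrier := {x | ∀ y ∈ E, x * y ∈ A.nonunits}
      one_mem' := fun y hy => by simpa using hy.2.2
      zero_mem' := fun y hy => by
        rw [zero_mul]
        exact A.nonunits.zero_mem
      add_mem' := fun {a b} ha hb y hy => by
        rw [add_mul]
        exact add_mem (ha y hy) (hb y hy)
      neg_mem' := fun {a} ha y hy => by
        rw [neg_mul]
        exact neg_mem (ha y hy)
      -- If `b ∈ S`, multiplication by `b` maps `E` to itself; otherwise `b` already lies in `A`.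
      mul_mem' := fun {a b} ha hb y hy => by
        by_cases hbS : b ∈ S
        · rw [mul_assoc]
          exact ha _ ⟨mul_ne_zero (hS.ne_zero hbS) hy.1,
            fun h => hy.2.1 ((hS.mul_mem_iff_right hbS).1 h), hb y hy⟩
        · rw [mul_right_comm, mul_comm]
          exact A.mul_mem_nonunits (notMem_of b hb hbS) (ha y hy) }
  have hAR : A.toSubring ≤ R₀ := fun x hx y hy => A.mul_mem_nonunits hx hy.2.2
  refine ⟨A.ofLE R₀ hAR, ?_, ?_⟩
  · have hz : ∃ e, e ∈ E := by
      obtain ⟨z, hz0, hz⟩ := hne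
      rcases A.mem_or_inv_mem z with h | h
      · exact ⟨z, hz0, hz, mem_nonunits z h hz⟩
      · have hz' : z⁻¹ ∉ S := fun h => hz (hS.inv_mem_iff.1 h)
        exact ⟨z⁻¹, inv_ne_zero hz0, hz', mem_nonunits _ h hz'⟩
    obtain ⟨e, he⟩ := hz
    refine ValuationSubring.ne_top_of_notMem (x := e⁻¹) fun h => ?_
    have : e⁻¹ * e ∈ A.nonunits := h e he
    rw [inv_mul_cancel₀ he.1] at this
    exact A.one_notMem_nonunits this
  · have hEdef : CoordDefinableSet K E := by
      unfold CoordDefinableSet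
      simp only [hE]
      exact .and (.not (.eq (.proj 0) (.const 0))) (.and (.not (hdef.mem (.proj 0)))
        (hdef.mem (.add (.const 1) (.proj 0))))
    have key : ∀ x, x ∈ (A.ofLE R₀ hAR : Set L) ↔
        x = 0 ∨ (x ∈ S ∧ ∀ y, y ∈ E → x * y ∈ E) ∨ x ∈ E := by
      intro x
      have hmem : x ∈ (A.ofLE R₀ hAR : Set L) ↔ ∀ y ∈ E, x * y ∈ A.nonunits := Iff.rfl
      rw [hmem]
      constructor
      · intro h
        by_cases hxS : x ∈ S
        · exact Or.inr (Or.inl ⟨hxS, fun y hy => ⟨mul_ne_zero (hS.ne_zero hxS) hy.1,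
            fun h' => hy.2.1 ((hS.mul_mem_iff_right hxS).1 h'), h y hy⟩⟩)
        · by_cases h0 : x = 0
          · exact Or.inl h0
          · exact Or.inr (Or.inr ⟨h0, hxS, mem_nonunits x (notMem_of x h hxS) hxS⟩)
      · rintro (rfl | ⟨-, h⟩ | h) y hy
        · rw [zero_mul]; exact A.nonunits.zero_mem
        · exact (h y hy).2.2
        · exact A.mul_mem_nonunits (A.mem_of_mem_nonunits h.2.2) hy.2.2
    unfold CoordDefinableSet
    simp only [key]
    exact .or (.eq (.proj 0) (.const 0)) (.or (.and (hdef.mem (.proj 0))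
      (.all (.imp (hEdef.mem (.proj 0)) (hEdef.mem (.mul (.proj (Fin.succ 0)) (.proj 0))))))
      (hEdef.mem (.proj 0)))

end Subgroups

/-! ### Additive subgroups containing a valuation ring -/

section AdditiveSubgroups

variable {K L : Type*} [Field K] [Field L] [Algebra K L] [FiniteDimensional K L]
  {p : ℕ} [Fact p.Prime] [CharP L p]

theorem CoordDefinableSet.inv {S : Set L} (h : CoordDefinableSet K S) :
    CoordDefinableSet K {y | y⁻¹ ∈ S} := by
  have key : ∀ y : L, y ∈ {y : L | y⁻¹ ∈ S} ↔
      ∃ u, u ∈ S ∧ ((y = 0 ∧ u = 0) ∨ y * u = 1) := by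
    intro y
    constructor
    · intro hy
      refine ⟨y⁻¹, hy, ?_⟩
      by_cases h0 : y = 0
      · simp [h0]
      · exact Or.inr (mul_inv_cancel₀ h0)
    · rintro ⟨u, hu, ⟨rfl, rfl⟩ | hyu⟩
      · simpa using hu
      · rwa [Set.mem_ofPred_eq, inv_eq_of_mul_eq_one_right hyu]
  unfold CoordDefinableSet
  simp only [key]
  exact .ex (.and (h.mem (.proj 0)) (.or (.and (.eq (.proj (Fin.succ 0)) (.const 0))
    (.eq (.proj 0) (.const 0))) (.eq (.mul (.proj (Fin.succ 0)) (.proj 0)) (.const 1))))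

theorem CoordDefinableSet.of_nonunits {B : ValuationSubring L}
    (h : CoordDefinableSet K (B.nonunits : Set L)) : CoordDefinableSet K (B : Set L) := by
  have key : ∀ x, x ∈ (B : Set L) ↔ ¬ ∃ y, y ∈ (B.nonunits : Set L) ∧ x * y = 1 := by
    intro x
    constructor
    · rintro hx ⟨y, hy, hxy⟩
      exact B.one_notMem_nonunits (hxy ▸ B.mul_mem_nonunits hx hy)
    · intro h'
      by_contra hx
      exact h' ⟨x⁻¹, B.inv_mem_nonunits_of_notMem hx, mul_inv_cancel₀ fun h0 => hx (h0 ▸ B.zero_mem)⟩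
  unfold CoordDefinableSet
  simp only [key]
  exact .not (.ex (.and (h.mem (.proj 0)) (.eq (.mul (.proj (Fin.succ 0)) (.proj 0)) (.const 1))))

theorem AddSubgroup.pow_mem_iff_of_artinSchreier_le {T : AddSubgroup L}
    (hT : (artinSchreierHom L p).range ≤ T) (x : L) : x ^ p ∈ T ↔ x ∈ T := by
  have h : x ^ p - x ∈ T := hT ⟨x, rfl⟩
  constructor
  · intro h'
    simpa using T.sub_mem h' h
  · intro h'
    simpa using T.add_mem h h'

/-- The largest overring of a valuation ring contained in a given additive subgroup that is
closed under Artin–Schreier equivalence. -/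
theorem exists_largest_overring_subset (hperf : ∀ x : L, ∃ y, y ^ p = x) (A : ValuationSubring L)
    {T : AddSubgroup L} (hT : (artinSchreierHom L p).range ≤ T) (hA : ∀ x ∈ A, x ∈ T) :
    ∃ B : ValuationSubring L, ∀ x, x ∈ B ↔ ∀ b ∈ B, x * b ∈ T := by
  have hp := (Fact.out : p.Prime)
  -- Every `a ∈ A` is a `p`-th power from `A`, so `x * A ⊆ T` passes to `x ^ p`, and then to `x ^ 2`
  -- when `x⁻¹ ∈ A`. Squares give all products: `x * y` is `x ^ 2` or `y ^ 2` times an element of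
  -- `A`.
  have hsq : ∀ x, (∀ a ∈ A, x * a ∈ T) → ∀ a ∈ A, x ^ 2 * a ∈ T := by
    intro x hx
    have hpow : ∀ a ∈ A, x ^ p * a ∈ T := by
      intro a ha
      obtain ⟨b, rfl⟩ := hperf a
      rw [← mul_pow, AddSubgroup.pow_mem_iff_of_artinSchreier_le hT]
      exact hx b (A.mem_of_pow_mem hp.ne_zero ha)
    intro a ha
    rcases A.mem_or_inv_mem x with h | h
    · rw [sq, mul_assoc]
      exact hx _ (A.mul_mem _ _ h ha)
    · by_cases h0 : x = 0
      · simp [h0, T.zero_mem]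
      · have := hpow _ (A.mul_mem _ _ (A.pow_mem h (p - 2)) ha)
        rwa [← mul_assoc, show x ^ p = x ^ 2 * x ^ (p - 2) by
          rw [← pow_add]; congr 1; have := hp.two_le; omega, mul_assoc (x ^ 2), ← mul_pow,
          mul_inv_cancel₀ h0, one_pow, mul_one] at this
  let R₀ : Subring L :=
    { carrier := {x | ∀ a ∈ A, x * a ∈ T}
      one_mem' := fun a ha => by
        rw [one_mul]
        exact hA a ha
      zero_mem' := fun a ha => by
        rw [zero_mul]
        exact T.zero_mem
      add_mem' := fun {x y} hx hy a ha => by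
        rw [add_mul]
        exact T.add_mem (hx a ha) (hy a ha)
      neg_mem' := fun {x} hx a ha => by
        rw [neg_mul]
        exact T.neg_mem (hx a ha)
      mul_mem' := fun {x y} hx hy => by
        by_cases hy0 : y = 0
        · intro a ha
          simp [hy0, T.zero_mem]
        by_cases hx0 : x = 0
        · intro a ha
          simp [hx0, T.zero_mem]
        rcases A.mem_or_inv_mem (y * x⁻¹) with h | h
        · intro a ha
          have := hsq x hx _ (A.mul_mem _ _ h ha)
          rwa [show x ^ 2 * (y * x⁻¹ * a) = x * y * a by field_simp] at this
        · intro a ha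
          have := hsq y hy _ (A.mul_mem _ _ h ha)
          rwa [show y ^ 2 * ((y * x⁻¹)⁻¹ * a) = x * y * a by field_simp] at this }
  have hAR : A.toSubring ≤ R₀ := fun x hx a ha => hA _ (A.mul_mem _ _ hx ha)
  refine ⟨A.ofLE R₀ hAR, fun x => ⟨fun hx b hb => ?_, fun h a ha => h a (hAR ha)⟩⟩
  have : x * b ∈ R₀ := R₀.mul_mem hx hb
  simpa using this 1 A.one_mem

/-- For `B` the largest overring inside `T`, inverses of elements outside `T` lie in the maximal
ideal of `B`. Maximality provides enough of them for their differences to exhaust that ideal. -/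
theorem exists_definable_of_subset_addSubgroup (hperf : ∀ x : L, ∃ y, y ^ p = x)
    (A : ValuationSubring L) {T : AddSubgroup L} (hdef : CoordDefinableSet K (T : Set L))
    (hT : (artinSchreierHom L p).range ≤ T) (hA : ∀ x ∈ A, x ∈ T) (hne : ∃ z, z ∉ T) :
    ∃ R : ValuationSubring L, R ≠ ⊤ ∧ CoordDefinableSet K (R : Set L) := by
  have hp := (Fact.out : p.Prime)
  obtain ⟨B, hB⟩ := exists_largest_overring_subset hperf A hT hA
  have hBT : ∀ x ∈ B, x ∈ T := fun x hx => by simpa using (hB x).1 hx 1 B.one_mem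
  have hY : ∀ z, z ∉ T → z⁻¹ ∈ B.nonunits := fun z hz =>
    B.inv_mem_nonunits_of_notMem fun h => hz (hBT z h)
  have key : ∀ x, x ∈ B.nonunits ↔ ∃ y z, y⁻¹ ∉ T ∧ z⁻¹ ∉ T ∧ x = y - z := by
    intro x
    constructor
    · intro hx
      by_cases h0 : x = 0
      · obtain ⟨z, hz⟩ := hne
        exact ⟨z⁻¹, z⁻¹, by simpa, by simpa, by simp [h0]⟩
      -- Passing to the `p`-th root yields `y = x' * b⁻¹` with `y⁻¹ ∉ T`, for which `x * y⁻¹ ^ 2 =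
      -- x' ^ (p - 2) * b ^ 2` is still in `B`.
      obtain ⟨x', hx'⟩ := hperf x
      have h1 : x' ∈ B.nonunits := B.mem_nonunits_of_pow_mem hp.ne_zero (hx' ▸ hx)
      have h0' : x' ≠ 0 := by
        rintro rfl
        exact h0 (by rw [← hx', zero_pow hp.ne_zero])
      have h2 : ¬ ∀ b ∈ B, x'⁻¹ * b ∈ T := fun h =>
        B.inv_notMem_of_mem_nonunits h1 h0' ((hB _).2 h)
      push Not at h2
      obtain ⟨b, hb, hbT⟩ := h2
      have hb0 : b ≠ 0 := by
        rintro rfl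
        exact hbT (by simp [T.zero_mem])
      set y := (x'⁻¹ * b)⁻¹ with hy
      have hy0 : y ≠ 0 := by positivity
      have hyM : y ∈ B.nonunits := hY _ hbT
      have h3 : x * y⁻¹ ^ 2 ∈ B := by
        rw [hy, inv_inv, ← hx', show x' ^ p * (x'⁻¹ * b) ^ 2 = x' ^ (p - 2) * b ^ 2 by
          rw [show x' ^ p = x' ^ (p - 2) * x' ^ 2 by
            rw [← pow_add]; congr 1; have := hp.two_le; omega]
          field_simp]
        exact B.mul_mem _ _ (B.pow_mem (B.mem_of_mem_nonunits h1) _) (B.pow_mem hb _)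
      set e := x * y⁻¹ ^ 2 with he
      have hey : -(e * y) ∈ B.nonunits := neg_mem (B.mul_mem_nonunits h3 hyM)
      have hxe : x = e * y ^ 2 := by rw [he]; field_simp
      have hne' := B.one_add_ne_zero hey
      -- Thus `(y - x)⁻¹` and `y⁻¹` differ by an element of `B ⊆ T`, so both are outside `T`, and `x
      -- = y - (y - x)`.
      have h4 : (y - x)⁻¹ = y⁻¹ + e * (1 + -(e * y))⁻¹ := by
        have : y - x = y * (1 + -(e * y)) := by rw [hxe]; ring
        rw [this, mul_inv]
        generalize hg : 1 + -(e * y) = g at hne'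
        field_simp
        linear_combination hg
      refine ⟨y, y - x, by simpa [hy] using hbT, ?_, by ring⟩
      rw [h4]
      intro h5
      have := T.sub_mem h5 (hBT _ (B.mul_mem _ _ h3 (B.inv_one_add_mem hey)))
      rw [add_sub_cancel_right, hy, inv_inv] at this
      exact hbT this
    · rintro ⟨y, z, hy, hz, rfl⟩
      simpa using sub_mem (hY _ hy) (hY _ hz)
  refine ⟨B, ?_, ?_⟩
  · obtain ⟨z, hz⟩ := hne
    exact ValuationSubring.ne_top_of_notMem fun h => hz (hBT z h)
  · refine .of_nonunits ?_
    unfold CoordDefinableSet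
    simp only [SetLike.mem_coe, key]
    exact .ex (.ex (.and (.not (hdef.inv.mem (.proj (Fin.succ 0)))) (.and
      (.not (hdef.inv.mem (.proj 0)))
      (.eq (.proj (Fin.succ (Fin.succ 0))) (.sub (.proj (Fin.succ 0)) (.proj 0))))))

end AdditiveSubgroups

/-! ### Valuation rings up to a bounded scaling -/

/-- A subset `W` of a valuation ring `A` which behaves like a valuation ring up to scaling by the
unit `b` of `A`. -/
structure IsQuasiValuation {L : Type*} [Field L] (A : ValuationSubring L) (W : Set L) (b : L) :
    Prop where
  ne_zero : b ≠ 0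
  mem : b ∈ A
  inv_mem : b⁻¹ ∈ A
  subset : W ⊆ A
  nonunits_subset : (A.nonunits : Set L) ⊆ W
  mem_or_inv_mem : ∀ x, x ∈ W ∨ x⁻¹ ∈ W
  add_mem : ∀ {x y}, x ∈ W → y ∈ W → b * (x + y) ∈ W
  mul_mem : ∀ {x y}, x ∈ W → y ∈ W → b * (x * y) ∈ W

namespace IsQuasiValuation

variable {L : Type*} [Field L] {A : ValuationSubring L} {W : Set L} {b : L}
  {x y : L} {i j : ℕ}
theorem zero_mem (h : IsQuasiValuation A W b) : (0 : L) ∈ W := by simpa using h.mem_or_inv_mem 0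

theorem one_mem (h : IsQuasiValuation A W b) : (1 : L) ∈ W := by simpa using h.mem_or_inv_mem 1

theorem neg_one_mem (h : IsQuasiValuation A W b) : (-1 : L) ∈ W := by
  simpa using h.mem_or_inv_mem (-1)

theorem smul_mem (h : IsQuasiValuation A W b) (hx : x ∈ W) : b * x ∈ W := by
  simpa using h.add_mem hx h.zero_mem

theorem pow_smul_mem (h : IsQuasiValuation A W b) (hx : x ∈ W) (n : ℕ) : b ^ n * x ∈ W := by
  induction n with
  | zero => simpa
  | succ n ih => simpa [pow_succ', mul_assoc] using h.smul_mem ih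

theorem scale_mono (h : IsQuasiValuation A W b) (hij : i ≤ j) (hx : b ^ i * x ∈ W) :
    b ^ j * x ∈ W := by
  obtain ⟨k, rfl⟩ := Nat.exists_eq_add_of_le hij
  rw [add_comm, pow_add, mul_assoc]
  exact h.pow_smul_mem hx k

theorem scale_add (h : IsQuasiValuation A W b) (hx : b ^ i * x ∈ W) (hy : b ^ i * y ∈ W) :
    b ^ (i + 1) * (x + y) ∈ W := by
  have := h.add_mem hx hy
  rwa [← mul_add, ← mul_assoc, ← pow_succ'] at this

theorem scale_mul (h : IsQuasiValuation A W b) (hx : b ^ i * x ∈ W) (hy : b ^ j * y ∈ W) :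
    b ^ (i + j + 1) * (x * y) ∈ W := by
  have := h.mul_mem hx hy
  rwa [show b * (b ^ i * x * (b ^ j * y)) = b ^ (i + j + 1) * (x * y) by ring] at this

theorem mem_of_scale_mem (h : IsQuasiValuation A W b) (hx : b ^ i * x ∈ W) : x ∈ A := by
  have := A.mul_mem _ _ (A.pow_mem h.inv_mem i) (h.subset hx)
  rwa [← mul_assoc, ← mul_pow, inv_mul_cancel₀ h.ne_zero, one_pow, one_mul] at this

theorem scale_pow (h : IsQuasiValuation A W b) (hx : x ∈ W) (m : ℕ) : b ^ m * x ^ m ∈ W := by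
  induction m with
  | zero => simpa using h.one_mem
  | succ m ih =>
    have := h.mul_mem hx ih
    rwa [show b * (x * (b ^ m * x ^ m)) = b ^ (m + 1) * x ^ (m + 1) by ring] at this

/-- An element whose cube-rescaling is outside `W` has inverse with small powers. -/
theorem inv_pow_mem (h : IsQuasiValuation A W b) (hx : b ^ 3 * x ∉ W) (m : ℕ) :
    (b⁻¹) ^ (2 * m) * (x⁻¹) ^ m ∈ W := by
  -- Inverting `b ^ 3 * x` gains `b⁻¹ ^ (3 * m)` in the `m`-th power, while multiplying costs only
  -- `b ^ m`.
  have h1 := h.scale_pow ((h.mem_or_inv_mem _).resolve_left hx) m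
  rwa [mul_inv, mul_pow, ← mul_assoc, show b ^ m * ((b ^ 3)⁻¹) ^ m = (b⁻¹) ^ (2 * m) by
    have := h.ne_zero
    rw [inv_pow, inv_pow, ← pow_mul, pow_mul]
    field_simp
    ring] at h1

theorem inv_pow_mem' (h : IsQuasiValuation A W b) (hx : b ^ 3 * x ∉ W) (m : ℕ) : (x⁻¹) ^ m ∈ W := by
  have := h.pow_smul_mem (h.inv_pow_mem hx m) (2 * m)
  rwa [← mul_assoc, ← mul_pow, mul_inv_cancel₀ h.ne_zero, one_pow, one_mul] at this

/-- The valuation ring of elements absorbed by some rescaling of `W`. -/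
theorem exists_valuationSubring_of_unabsorbed (h : IsQuasiValuation A W b) {z : L} (hzA : z ∈ A)
    (hz : ∀ j : ℕ, b ^ j * z ∉ W) :
    ∃ O : ValuationSubring L, O ≤ A ∧ z ∉ O ∧
      ∃ d ∈ A, d⁻¹ ∈ A ∧ d ≠ 0 ∧ ∀ x ∈ O, d * x ∈ W := by
  let O₀ : Subring L :=
    { carrier := {x | ∃ j : ℕ, b ^ j * x ∈ W}
      one_mem' := ⟨0, by simpa using h.one_mem⟩
      zero_mem' := ⟨0, by simpa using h.zero_mem⟩
      add_mem' := by
        rintro x y ⟨i, hi⟩ ⟨j, hj⟩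
        exact ⟨i + j + 1, h.scale_add (h.scale_mono (Nat.le_add_right i j) hi)
          (h.scale_mono (Nat.le_add_left j i) hj)⟩
      mul_mem' := by
        rintro x y ⟨i, hi⟩ ⟨j, hj⟩
        exact ⟨i + j + 1, h.scale_mul hi hj⟩
      neg_mem' := by
        rintro x ⟨i, hi⟩
        refine ⟨0 + i + 1, ?_⟩
        have := h.scale_mul (i := 0) (by simpa using h.neg_one_mem) hi
        rwa [neg_one_mul] at this }
  have hval : ∀ x, x ∈ O₀ ∨ x⁻¹ ∈ O₀ := fun x =>
    (h.mem_or_inv_mem x).imp (fun hx => ⟨0, by simpa using hx⟩) (fun hx => ⟨0, by simpa using hx⟩)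
  have hzO : z ∉ O₀ := fun ⟨j, hj⟩ => hz j hj
  have hz0 : z ≠ 0 := fun h0 => hzO (h0 ▸ O₀.zero_mem)
  have hle : ∀ x ∈ O₀, x ∈ A := fun x ⟨j, hj⟩ => h.mem_of_scale_mem hj
  -- The scaling `d = z⁻¹` works: were `z⁻¹ * x ∉ W`, its inverse would be in `W`, and multiplying
  -- by `x ∈ O₀` would put `z` into `O₀`.
  refine ⟨.ofSubring O₀ hval, hle, hzO, z⁻¹, hle _ ((hval z).resolve_left hzO), by simpa,
    inv_ne_zero hz0, fun x hx => ?_⟩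
  by_contra hx'
  have hx0 : x ≠ 0 := by
    rintro rfl
    exact hx' (by simpa using h.zero_mem)
  have h1 := (h.mem_or_inv_mem _).resolve_left hx'
  obtain ⟨j, hj⟩ : x ∈ O₀ := hx
  refine hz (0 + j + 1) ?_
  have := h.scale_mul (i := 0) (x := (z⁻¹ * x)⁻¹) (by rwa [pow_zero, one_mul]) hj
  rwa [show (z⁻¹ * x)⁻¹ * x = z by field_simp] at this

/-- The valuation ring of power-bounded elements, in characteristic `p`. -/
theorem exists_valuationSubring_of_absorbed (h : IsQuasiValuation A W b) (p : ℕ) [Fact p.Prime] [CharP L p]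
    {z : L} (hzA : z ∈ A) (hz : z ∉ W) (habs : ∀ x ∈ A, ∃ j : ℕ, b ^ j * x ∈ W) :
    ∃ O : ValuationSubring L, O ≤ A ∧ (∃ x ∈ A, x ∉ O) ∧
      ∃ d ∈ A, d⁻¹ ∈ A ∧ d ≠ 0 ∧ ∀ x ∈ O, d * x ∈ W := by
  have hp := (Fact.out : p.Prime)
  have hb := h.ne_zero
  -- A large power of `b⁻¹` in `W` would cancel the scaling that absorbs `z` and force `z ∈ W`.
  have hunb : ∃ N₀, ∀ N ≥ N₀, (b⁻¹) ^ N ∉ W := by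
    obtain ⟨j, hj⟩ := habs z hzA
    refine ⟨j + 1, fun N hN hNW => hz ?_⟩
    obtain ⟨k, rfl⟩ := Nat.exists_eq_add_of_le hN
    have := h.pow_smul_mem (h.mul_mem hj hNW) k
    rwa [show b ^ k * (b * (b ^ j * z * b⁻¹ ^ (j + 1 + k))) = z by
      rw [inv_pow]; field_simp; ring] at this
  obtain ⟨N₀, hN₀⟩ := hunb
  have hlarge : ∀ j : ℕ, ∃ n, N₀ + j ≤ p ^ n := fun j =>
    ⟨N₀ + j, (Nat.lt_pow_self hp.one_lt).le⟩
  have hdescale : ∀ j N : ℕ, j ≤ N → b ^ j * (b⁻¹) ^ N = (b⁻¹) ^ (N - j) := by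
    intro j N hjN
    obtain ⟨k, rfl⟩ := Nat.exists_eq_add_of_le hjN
    rw [Nat.add_sub_cancel_left, pow_add, ← mul_assoc, ← mul_pow, mul_inv_cancel₀ hb, one_pow,
      one_mul]
  have hbdd : ∀ x, (∃ j : ℕ, ∀ n : ℕ, b ^ j * x ^ p ^ n ∈ W) → b ^ 3 * x ∈ W := by
    rintro x ⟨j, hj⟩
    by_contra hx
    have hx0 : x ≠ 0 := by
      rintro rfl
      exact hx (by simpa using h.zero_mem)
    obtain ⟨n, hn⟩ := hlarge (j + 1)
    have := h.scale_mul (i := 0)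
      (by rw [pow_zero, one_mul]; exact h.inv_pow_mem hx (p ^ n)) (hj n)
    rw [inv_pow x, mul_assoc, inv_mul_cancel₀ (pow_ne_zero _ hx0), mul_one, hdescale _ _ (by omega)]
      at this
    exact hN₀ _ (by omega) this
  have hadd : ∀ x y, (∃ j : ℕ, ∀ n : ℕ, b ^ j * x ^ p ^ n ∈ W) →
      (∃ j : ℕ, ∀ n : ℕ, b ^ j * y ^ p ^ n ∈ W) →
      (∃ j : ℕ, ∀ n : ℕ, b ^ j * (x + y) ^ p ^ n ∈ W) := by
    rintro x y ⟨i, hi⟩ ⟨j, hj⟩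
    refine ⟨i + j + 1, fun n => ?_⟩
    rw [add_pow_char_pow]
    exact h.scale_add (h.scale_mono (Nat.le_add_right i j) (hi n))
          (h.scale_mono (Nat.le_add_left j i) (hj n))
  have hmul : ∀ x y, (∃ j : ℕ, ∀ n : ℕ, b ^ j * x ^ p ^ n ∈ W) →
      (∃ j : ℕ, ∀ n : ℕ, b ^ j * y ^ p ^ n ∈ W) →
      (∃ j : ℕ, ∀ n : ℕ, b ^ j * (x * y) ^ p ^ n ∈ W) := by
    rintro x y ⟨i, hi⟩ ⟨j, hj⟩
    refine ⟨i + j + 1, fun n => ?_⟩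
    rw [mul_pow]
    exact h.scale_mul (hi n) (hj n)
  -- Bounding only the exponents `p ^ n` makes closure under addition immediate from Frobenius.
  let O₀ : Subring L :=
    { carrier := {x | ∃ j : ℕ, ∀ n : ℕ, b ^ j * x ^ p ^ n ∈ W}
      one_mem' := ⟨0, fun n => by simpa using h.one_mem⟩
      zero_mem' := ⟨0, fun n => by simpa [hp.ne_zero] using h.zero_mem⟩
      add_mem' := fun hx hy => hadd _ _ hx hy
      mul_mem' := fun hx hy => hmul _ _ hx hy
      neg_mem' := by
        intro x hx
        have h1 : ∃ j : ℕ, ∀ n : ℕ, b ^ j * (-1) ^ p ^ n ∈ W := by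
          refine ⟨0, fun n => ?_⟩
          rcases neg_one_pow_eq_or L (p ^ n) with h1 | h1
          · simpa [h1] using h.one_mem
          · simpa [h1] using h.neg_one_mem
        have := hmul _ _ h1 hx
        rwa [neg_one_mul] at this }
  -- If the bound fails at `n`, all powers of `(x ^ p ^ n)⁻¹` are in `W`. The finitely many smaller
  -- exponents are absorbed by a common scaling, the sum of the individual ones.
  have hval : ∀ x, x ∈ O₀ ∨ x⁻¹ ∈ O₀ := by
    intro x
    by_cases hxA : x ∈ A
    · by_cases hx : ∀ n : ℕ, b ^ 3 * x ^ p ^ n ∈ W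
      · exact Or.inl ⟨3, hx⟩
      push Not at hx
      obtain ⟨n, hn⟩ := hx
      have hinv := h.inv_pow_mem' hn
      simp only [← inv_pow] at hinv
      have hxA' : x⁻¹ ∈ A := A.mem_of_pow_mem (pow_ne_zero n hp.ne_zero)
        (h.subset (by simpa using hinv 1))
      choose j hj using fun m : ℕ => habs _ (A.pow_mem hxA' (p ^ m))
      refine Or.inr ⟨∑ m ∈ Finset.range n, j m, fun m => ?_⟩
      rcases lt_or_ge m n with hm | hm
      · exact h.scale_mono (Finset.single_le_sum (f := j) (fun _ _ => Nat.zero_le _)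
          (Finset.mem_range.2 hm)) (hj m)
      · obtain ⟨k, rfl⟩ := Nat.exists_eq_add_of_le hm
        refine h.pow_smul_mem ?_ _
        rw [pow_add, pow_mul]
        exact hinv _
    · refine Or.inr ⟨0, fun n => ?_⟩
      rw [pow_zero, one_mul]
      refine h.nonunits_subset ?_
      have h1 := A.inv_mem_nonunits_of_notMem hxA
      obtain ⟨k, hk⟩ := Nat.exists_eq_succ_of_ne_zero (pow_ne_zero n hp.ne_zero)
      rw [hk, pow_succ]
      exact A.mul_mem_nonunits (A.pow_mem (A.mem_of_mem_nonunits h1) k) h1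
  refine ⟨.ofSubring O₀ hval, ?_, ⟨b⁻¹, h.inv_mem, ?_⟩, b ^ 3, A.pow_mem h.mem 3, ?_,
    pow_ne_zero 3 hb, fun x hx => hbdd x hx⟩
  · rintro x ⟨j, hj⟩
    exact h.mem_of_scale_mem (by simpa using hj 0)
  · rintro ⟨j, hj⟩
    obtain ⟨n, hn⟩ := hlarge j
    have := hj n
    rw [hdescale _ _ (by omega)] at this
    exact hN₀ _ (by omega) this
  · rw [← inv_pow]
    exact A.pow_mem h.inv_mem 3

/-- Either some element of `A` escapes every rescaling of `W`, and the absorbed elements form a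
smaller ring, or none does, and the Frobenius-bounded elements do. -/
theorem exists_valuationSubring_lt (h : IsQuasiValuation A W b) (p : ℕ) [Fact p.Prime] [CharP L p]
    {z : L} (hzA : z ∈ A) (hz : z ∉ W) :
    ∃ O : ValuationSubring L, O ≤ A ∧ (∃ x ∈ A, x ∉ O) ∧
      ∃ d ∈ A, d⁻¹ ∈ A ∧ d ≠ 0 ∧ ∀ x ∈ O, d * x ∈ W := by
  by_cases habs : ∀ x ∈ A, ∃ j : ℕ, b ^ j * x ∈ W
  · exact h.exists_valuationSubring_of_absorbed p hzA hz habs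
  · push Not at habs
    obtain ⟨y, hyA, hy⟩ := habs
    obtain ⟨O, hOA, hyO, hd⟩ := h.exists_valuationSubring_of_unabsorbed hyA hy
    exact ⟨O, hOA, ⟨y, hyA, hyO⟩, hd⟩

end IsQuasiValuation

/-! ### Definability of a minimal valuation ring -/

section BoundedSets

variable {K L : Type*} [Field K] [Field L] [Algebra K L] [FiniteDimensional K L]

/-- The sets generated from constants `C` and inverses of elements outside `P` in `n` rounds of
addition and multiplication. -/
def boundedSets (P C : Set L) : ℕ → Set L
  | 0 => C ∪ {y | ¬ y⁻¹ ∈ P}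
  | n + 1 => {x | ∃ a ∈ boundedSets P C n, ∃ b ∈ boundedSets P C n, ∃ c ∈ boundedSets P C n,
      x = a + b * c}

namespace boundedSets

variable {P C : Set L}

theorem definable (hP : CoordDefinableSet K P) (hC : C.Finite) (n : ℕ) :
    CoordDefinableSet K (boundedSets P C n) := by
  induction n with
  | zero =>
    have hC' : CoordDefinableSet K C := by
      have : Finite C := hC
      have key : ∀ x, x ∈ C ↔ ∃ c : C, x = c := by simp
      unfold CoordDefinableSet
      simp only [key]
      exact .finite_ex fun c => .eq (.proj 0) (.const _)
    exact .or (hC'.mem (.proj 0)) (.not (hP.inv.mem (.proj 0)))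
  | succ n ih => exact ih.add_mul_self

variable {n : ℕ} {x y : L}

theorem subset_valuationSubring {A : ValuationSubring L} (hP : (A.nonunits : Set L) ⊆ P)
    (hC : C ⊆ A) (n : ℕ) : boundedSets P C n ⊆ A := by
  induction n with
  | zero =>
    rintro x (hx | hx)
    · exact hC hx
    · by_contra h
      exact hx (hP (A.inv_mem_nonunits_of_notMem h))
  | succ n ih =>
    rintro x ⟨a, ha, b, hb, c, hc, rfl⟩
    exact A.add_mem _ _ (ih ha) (A.mul_mem _ _ (ih hb) (ih hc))


theorem zero_mem (h0 : 0 ∈ C) (n : ℕ) : 0 ∈ boundedSets P C n := by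
  induction n with
  | zero => exact Or.inl h0
  | succ n ih => exact ⟨0, ih, 0, ih, 0, ih, by simp⟩

theorem subset_succ (h0 : 0 ∈ C) (n : ℕ) : boundedSets P C n ⊆ boundedSets P C (n + 1) := fun x hx =>
  ⟨x, hx, 0, zero_mem h0 n, 0, zero_mem h0 n, by simp⟩

theorem mono (h0 : 0 ∈ C) : Monotone (boundedSets P C) := monotone_nat_of_le_succ (subset_succ h0)

theorem mem_of_mem_const (h0 : 0 ∈ C) {c : L} (hc : c ∈ C) (n : ℕ) : c ∈ boundedSets P C n :=
  mono h0 (Nat.zero_le n) (Or.inl hc)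

theorem mul_mem (h0 : 0 ∈ C) (hx : x ∈ boundedSets P C n) (hy : y ∈ boundedSets P C n) :
    x * y ∈ boundedSets P C (n + 1) :=
  ⟨0, zero_mem h0 n, x, hx, y, hy, by simp⟩

theorem add_mem (h0 : 0 ∈ C) (h1 : 1 ∈ C) (hx : x ∈ boundedSets P C n)
    (hy : y ∈ boundedSets P C n) : x + y ∈ boundedSets P C (n + 1) :=
  ⟨x, hx, 1, mem_of_mem_const h0 h1 n, y, hy, by simp⟩

/-- If `c * w ∉ P`, then `(c * w)⁻¹` is a generator, and `w * (c * w)⁻¹ = c⁻¹`. -/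
theorem absorb_or_inv_mem (h0 : 0 ∈ C) (hP : 0 ∈ P) (c : L) (n : ℕ) :
    (∀ w ∈ boundedSets P C n, c * w ∈ P) ∨ c⁻¹ ∈ boundedSets P C (n + 1) := by
  by_contra! h
  obtain ⟨⟨w, hw, hcw⟩, hc⟩ := h
  have hne : c * w ≠ 0 := fun h => hcw (h ▸ hP)
  have hy : (c * w)⁻¹ ∈ boundedSets P C n := mono h0 (Nat.zero_le n) (Or.inr (by simpa using hcw))
  have := mul_mem h0 hw hy
  rw [show w * (c * w)⁻¹ = c⁻¹ by
    have := left_ne_zero_of_mul hne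
    have := right_ne_zero_of_mul hne
    field_simp] at this
  exact hc this

end boundedSets

theorem ValuationSubring.le_or_le_of_le {O A B : ValuationSubring L} (hA : O ≤ A) (hB : O ≤ B) :
    A ≤ B ∨ B ≤ A :=
  (ValuationSubring.le_total_ideal O).total ⟨A, hA⟩ ⟨B, hB⟩

/-- Write `W n` for `boundedSets P C n`. The candidate formula for the maximal ideal is `c * W 4 ⊆
P`. If a unit `c` of `A` satisfies it, `W 2` is a valuation ring up to scaling by `c`, which gives a
ring `O` strictly below `A` and a unit `d` of `A` with `c * d * O ⊆ P`. Then `hstar` contradicts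
minimality, or puts the unit `c * d` into the maximal ideal of `A`. -/
theorem exists_definable_of_minimal {p : ℕ} [Fact p.Prime] [CharP L p] {A : ValuationSubring L}
    (hA : A ≠ ⊤) {P C : Set L} (hdef : CoordDefinableSet K P) (hC : C.Finite)
    (hAP : (A.nonunits : Set L) ⊆ P) (hCA : C ⊆ A) (h0 : 0 ∈ C) (h1 : 1 ∈ C) {s : L} (hs : s ∈ C)
    (hsP : s ∉ P)
    (hmin : ∀ O : ValuationSubring L, O ≤ A → (O.nonunits : Set L) ⊆ P → A ≤ O)
    (hdich : ∀ x, x ∈ boundedSets P C 2 ∨ x⁻¹ ∈ boundedSets P C 2)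
    (hstar : ∀ O : ValuationSubring L, ∀ d, d ≠ 0 → (∀ x ∈ O, d * x ∈ P) →
      ∃ O' : ValuationSubring L, O ≤ O' ∧ (O'.nonunits : Set L) ⊆ P ∧ (O' = O ∨ d ∈ O'.nonunits)) :
    ∃ R : ValuationSubring L, R ≠ ⊤ ∧ CoordDefinableSet K (R : Set L) := by
  have hWA := boundedSets.subset_valuationSubring hAP hCA
  have hmono : Monotone (boundedSets P C) := boundedSets.mono h0
  refine ⟨A, hA, .of_nonunits ?_⟩
  by_cases h4 : ∀ c, (∀ w, w ∈ boundedSets P C 4 → c * w ∈ P) → c ∈ A.nonunits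
  · have key : ∀ c, c ∈ (A.nonunits : Set L) ↔ ∀ w, w ∈ boundedSets P C 4 → c * w ∈ P := by
      refine fun c => ⟨fun hc w hw => hAP ?_, h4 c⟩
      rw [mul_comm]
      exact A.mul_mem_nonunits (hWA 4 hw) hc
    unfold CoordDefinableSet
    simp only [key]
    exact .all (.imp ((boundedSets.definable hdef hC 4).mem (.proj 0))
      (hdef.mem (.mul (.proj (Fin.succ 0)) (.proj 0))))
  exfalso
  push Not at h4
  obtain ⟨c, hc, hcA⟩ := h4
  have hMW : (A.nonunits : Set L) ⊆ boundedSets P C 2 := by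
    intro x hx
    by_contra h
    have h' := hWA 2 ((hdich x).resolve_left h)
    exact A.inv_notMem_of_mem_nonunits hx
      (fun hx0 => h (hx0 ▸ boundedSets.zero_mem h0 2)) h'
  have hc0 : c ≠ 0 := fun h => hcA (h ▸ A.nonunits.zero_mem)
  -- Otherwise `w * ((c * w)⁻¹ * s)` would be in level 4, and `c` times it is `s ∉ P`. This is why
  -- level 4 is used: sums and products from level 2 are in level 3, and `c` brings them back to
  -- level 2.
  have hcs : ∀ w, w ≠ 0 → w ∈ boundedSets P C 3 → (c * w)⁻¹ ∉ boundedSets P C 2 := by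
    intro w hw0 hw h
    have := hc _ (boundedSets.mul_mem h0 hw
      (boundedSets.mul_mem h0 h (boundedSets.mem_of_mem_const h0 hs 2)))
    rw [show c * (w * ((c * w)⁻¹ * s)) = s by field_simp] at this
    exact hsP this
  have hcA' : c ∈ A := by
    by_contra h
    refine hcs 1 one_ne_zero (boundedSets.mem_of_mem_const h0 h1 3) ?_
    rw [mul_one]
    exact hMW (A.inv_mem_nonunits_of_notMem h)
  have hscale : ∀ w ∈ boundedSets P C 3, c * w ∈ boundedSets P C 2 := by
    intro w hw
    by_cases hw0 : w = 0
    · rw [hw0, mul_zero]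
      exact boundedSets.zero_mem h0 2
    · exact (hdich _).resolve_right (hcs w hw0 hw)
  have hquasi : IsQuasiValuation A (boundedSets P C 2) c :=
    { ne_zero := hc0
      mem := hcA'
      inv_mem := A.inv_mem_of_notMem_nonunits hcA
      subset := hWA 2
      nonunits_subset := hMW
      mem_or_inv_mem := hdich
      add_mem := fun hx hy => hscale _ (boundedSets.add_mem h0 h1 hx hy)
      mul_mem := fun hx hy => hscale _ (boundedSets.mul_mem h0 hx hy) }
  obtain ⟨O, hOA, ⟨y, hyA, hyO⟩, d, hdA, hdA', hd0, hd⟩ :=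
    hquasi.exists_valuationSubring_lt p (z := c⁻¹ * s)
      (A.mul_mem _ _ (A.inv_mem_of_notMem_nonunits hcA) (hCA hs)) (fun h => by
        have := hc _ (hmono (by norm_num : 2 ≤ 4) h)
        rw [mul_inv_cancel_left₀ hc0] at this
        exact hsP this)
  obtain ⟨O', hOO', hO'P, rfl | hdO'⟩ := hstar O (c * d) (mul_ne_zero hc0 hd0) (fun x hx => by
    rw [mul_assoc]
    exact hc _ (hmono (by norm_num : 2 ≤ 4) (hd x hx)))
  · exact hyO (hmin _ hOA hO'P hyA)
  · have hAO' : A ≤ O' := (ValuationSubring.le_or_le_of_le hOA hOO').elim id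
      fun h => hmin _ h hO'P
    have hM := ValuationSubring.nonunits_le_nonunits.2 hAO' hdO'
    refine A.inv_notMem_of_mem_nonunits hM (mul_ne_zero hc0 hd0) ?_
    rw [mul_inv]
    exact A.mul_mem _ _ (A.inv_mem_of_notMem_nonunits hcA) hdA'

/-- Divisibility in `O` is total, so closure under square roots already makes `I` prime; localizing
a valuation ring at a prime leaves that prime as the maximal ideal. -/
theorem ValuationSubring.exists_nonunits_eq_ideal (O : ValuationSubring L) (I : Ideal O)
    (hI : I ≠ ⊤) (hrad : ∀ x, x ^ 2 ∈ I → x ∈ I) :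
    ∃ O' : ValuationSubring L, O ≤ O' ∧ ∀ x, x ∈ O'.nonunits ↔ ∃ h : x ∈ O, ⟨x, h⟩ ∈ I := by
  have hprime : I.IsPrime := by
    refine ⟨hI, fun {x y} hxy => ?_⟩
    rcases ValuationRing.dvd_total x y with ⟨z, rfl⟩ | ⟨z, rfl⟩
    · refine Or.inr (hrad _ ?_)
      rw [show (x * z) ^ 2 = z * (x * (x * z)) by ring]
      exact I.mul_mem_left _ hxy
    · refine Or.inl (hrad _ ?_)
      rw [show (y * z) ^ 2 = z * ((y * z) * y) by ring]
      exact I.mul_mem_left _ hxy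
  have hle := O.le_ofPrime I
  refine ⟨O.ofPrime I, hle, fun x => ?_⟩
  have key : ∀ y : O, y ∈ I ↔ (y : L) ∈ (O.ofPrime I).nonunits := by
    intro y
    conv_lhs => rw [← O.idealOfLE_ofPrime I]
    exact ((O.ofPrime I).coe_mem_nonunits_iff (a := ⟨y, hle y.2⟩)).symm
  constructor
  · intro hx
    have hxO : x ∈ O := O.nonunits_subset (ValuationSubring.nonunits_le_nonunits.2 hle hx)
    exact ⟨hxO, (key ⟨x, hxO⟩).2 hx⟩
  · rintro ⟨h, hx⟩
    exact (key _).1 hx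

end BoundedSets

/-! ### Subgroups known to contain only `M` or `1 + M` -/

section FromNonunits

variable {K L : Type*} [Field K] [Field L] [Algebra K L] [FiniteDimensional K L]

/-- Zorn's lemma for reverse inclusion. The intersection of a chain is a valuation ring, and each of
its nonzero nonunits is a nonunit of some member, since its inverse is missing there. -/
theorem ValuationSubring.exists_minimal_nonunits_subset {P : Set L} (A₀ : ValuationSubring L)
    (h₀ : (A₀.nonunits : Set L) ⊆ P) :
    ∃ A ≤ A₀, (A.nonunits : Set L) ⊆ P ∧
      ∀ O : ValuationSubring L, O ≤ A → (O.nonunits : Set L) ⊆ P → A ≤ O := by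
  obtain ⟨A, hA, hmax⟩ := zorn_le_nonempty₀ (α := (ValuationSubring L)ᵒᵈ)
    {A | ((OrderDual.ofDual A).nonunits : Set L) ⊆ P} (fun c hc hchain y hy => by
      have hdir : ∀ x, (∃ B ∈ c, x ∉ OrderDual.ofDual B) →
          ∀ z, (∃ B ∈ c, z ∉ OrderDual.ofDual B) →
          ∃ B ∈ c, x ∉ OrderDual.ofDual B ∧ z ∉ OrderDual.ofDual B := by
        rintro x ⟨B, hB, hx⟩ z ⟨B', hB', hz⟩
        rcases hchain.total hB hB' with h | h
        · exact ⟨B', hB', fun h' => hx (h h'), hz⟩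
        · exact ⟨B, hB, hx, fun h' => hz (h h')⟩
      let R : Subring L := ⨅ B : c, (OrderDual.ofDual B.1).toSubring
      have hR : ∀ x, x ∈ R ↔ ∀ B ∈ c, x ∈ OrderDual.ofDual B := by
        intro x
        simp only [R, Subring.mem_iInf, Subtype.forall, mem_toSubring]
      refine ⟨OrderDual.toDual (ValuationSubring.ofSubring R fun x => ?_), ?_, ?_⟩
      · by_contra! h
        simp only [hR, not_forall] at h
        obtain ⟨⟨B, hB, h1⟩, B', hB', h2⟩ := h
        obtain ⟨E, hE, h3, h4⟩ := hdir _ ⟨B, hB, h1⟩ _ ⟨B', hB', h2⟩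
        exact h4 (((OrderDual.ofDual E).mem_or_inv_mem x).resolve_left h3)
      · intro x hx
        rcases (mem_nonunits_iff_or _).1 hx with rfl | h
        · exact hc hy (NonUnitalSubring.zero_mem _)
        · change ¬ x⁻¹ ∈ R at h
          simp only [hR, not_forall] at h
          obtain ⟨B, hB, h⟩ := h
          exact hc hB ((mem_nonunits_iff_or _).2 (Or.inr h))
      · intro B hB x hx
        exact (hR x).1 hx B hB) (OrderDual.toDual A₀) h₀
  exact ⟨OrderDual.ofDual A, hA, hmax.1, fun O hO hOP => hmax.2 (y := OrderDual.toDual O) hOP hO⟩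

variable {p : ℕ} [Fact p.Prime] [CharP L p]

theorem exists_definable_of_nonunits_subset_addSubgroup (hperf : ∀ x : L, ∃ y, y ^ p = x)
    {A₀ : ValuationSubring L} (hA₀ : A₀ ≠ ⊤) {T : AddSubgroup L}
    (hdef : CoordDefinableSet K (T : Set L)) (hT : (artinSchreierHom L p).range ≤ T)
    (hA₀T : (A₀.nonunits : Set L) ⊆ T) (hne : ∃ z, z ∉ T) :
    ∃ R : ValuationSubring L, R ≠ ⊤ ∧ CoordDefinableSet K (R : Set L) := by
  have hp := (Fact.out : p.Prime)
  obtain ⟨A, hAA₀, hAT, hmin⟩ := A₀.exists_minimal_nonunits_subset hA₀T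
  have hA : A ≠ ⊤ := fun h => hA₀ (top_le_iff.1 (h ▸ hAA₀))
  by_cases hsub : ∀ x ∈ A, x ∈ T
  · exact exists_definable_of_subset_addSubgroup hperf A hdef hT hsub hne
  push Not at hsub
  obtain ⟨s, hsA, hsT⟩ := hsub
  refine exists_definable_of_minimal (p := p) (C := {0, 1, -1, s}) hA hdef (by simp) hAT ?_
    (by simp) (by simp) (s := s) (by simp) hsT hmin ?_ ?_
  · rintro x (rfl | rfl | rfl | rfl)
    · exact A.zero_mem
    · exact A.one_mem
    · exact A.neg_mem _ A.one_mem
    · exact hsA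
  · intro x
    by_contra! h
    set C : Set L := {0, 1, -1, s} with hC
    obtain ⟨hx, hx'⟩ := h
    have h0 : (0 : L) ∈ C := by simp [hC]
    have h1 : (1 : L) ∈ C := by simp [hC]
    have hm1 : (-1 : L) ∈ C := by simp [hC]
    have hs : s ∈ C := by simp [hC]
    have hx0 : x ≠ 0 := fun h => hx (h ▸ boundedSets.zero_mem h0 2)
    have hx1 : 1 + x ≠ 0 := fun h =>
      hx ((eq_neg_of_add_eq_zero_right h) ▸ boundedSets.mem_of_mem_const h0 hm1 2)
    -- Applied to `x` and `x⁻¹`, this puts `s` in `T`, because `(1 + x)⁻¹ + (1 + x⁻¹)⁻¹ = 1`.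
    have key : ∀ z, z ∉ boundedSets (T : Set L) C 2 → (1 + z)⁻¹ * s ∈ T := by
      intro z hz
      refine (boundedSets.absorb_or_inv_mem h0 T.zero_mem (1 + z)⁻¹ 0).resolve_right (fun h => ?_)
        s (boundedSets.mem_of_mem_const h0 hs 0)
      rw [inv_inv] at h
      have := boundedSets.add_mem h0 h1 h (boundedSets.mem_of_mem_const h0 hm1 _)
      rw [add_neg_cancel_comm] at this
      exact hz this
    have := T.add_mem (key _ hx) (key _ hx')
    rw [← add_mul, show (1 + x)⁻¹ + (1 + x⁻¹)⁻¹ = 1 by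
      rw [show 1 + x⁻¹ = (1 + x) * x⁻¹ by field_simp; ring]
      field_simp, one_mul] at this
    exact hsT this
  · intro O d hd0 hd
    let I : Ideal O :=
      { carrier := {x | ∀ y ∈ O, (x : L) * y ∈ T}
        zero_mem' := fun y _ => by simp [T.zero_mem]
        add_mem' := fun {a b} ha hb y hy => by
          rw [Subring.coe_add, add_mul]
          exact T.add_mem (ha y hy) (hb y hy)
        smul_mem' := fun c a ha y hy => by
          rw [smul_eq_mul, Subring.coe_mul, mul_comm (c : L), mul_assoc]
          exact ha _ (O.mul_mem _ _ c.2 hy) }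
    by_cases hI : I = ⊤
    · refine ⟨O, le_rfl, fun x hx => ?_, Or.inl rfl⟩
      have : (1 : O) ∈ I := hI ▸ Submodule.mem_top
      simpa using this x (O.mem_of_mem_nonunits hx)
    · have hdO : d ∈ O := by
        by_contra h
        refine hI ((Ideal.eq_top_iff_one I).2 fun y hy => ?_)
        have := hd _ (O.mul_mem _ _ (O.mem_of_mem_nonunits (O.inv_mem_nonunits_of_notMem h)) hy)
        rw [mul_inv_cancel_left₀ hd0] at this
        simpa using this
      -- From `x ^ 2 ∈ I` follows `x ^ p * y ^ p ∈ T`, hence `x * y ∈ T`, as `T` absorbs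
      -- Artin–Schreier differences.
      obtain ⟨O', hO, hO'⟩ := O.exists_nonunits_eq_ideal I hI (fun x hx y hy => by
        rw [← AddSubgroup.pow_mem_iff_of_artinSchreier_le hT, mul_pow]
        have := hx _ (O.mul_mem _ _ (O.pow_mem x.2 (p - 2)) (O.pow_mem hy p))
        rwa [← mul_assoc, Subring.coe_pow, ← pow_add, Nat.add_sub_cancel' hp.two_le] at this)
      refine ⟨O', hO, fun x hx => ?_, Or.inr ((hO' d).2 ⟨hdO, hd⟩)⟩
      obtain ⟨hxO, hxI⟩ := (hO' x).1 hx
      simpa using hxI 1 O.one_mem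

theorem exists_definable_of_nonunits_subset_mulSubgroup (p : ℕ) [Fact p.Prime] [CharP L p]
    {q : ℕ} (hq : (q : L) ≠ 0)
    {A₀ : ValuationSubring L} (hA₀ : A₀ ≠ ⊤) {S : Set L} (hS : IsMulSubgroup S)
    (hdef : CoordDefinableSet K S) (hSq : ∀ x, x ≠ 0 → x ^ q ∈ S)
    (hA₀S : ∀ x ∈ A₀.nonunits, 1 + x ∈ S) (hne : ∃ z, z ≠ 0 ∧ z ∉ S) :
    ∃ R : ValuationSubring L, R ≠ ⊤ ∧ CoordDefinableSet K (R : Set L) := by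
  have hp := (Fact.out : p.Prime)
  obtain ⟨A, hAA₀, hAS, hmin⟩ := A₀.exists_minimal_nonunits_subset (P := {x | 1 + x ∈ S}) hA₀S
  have hA : A ≠ ⊤ := fun h => hA₀ (top_le_iff.1 (h ▸ hAA₀))
  by_cases hsub : ∀ x ∈ A, x ∉ A.nonunits → x ∈ S
  · exact exists_definable_of_units_subset A hS hdef hsub hne
  push Not at hsub
  obtain ⟨t, htA, htM, htS⟩ := hsub
  have ht0 : t ≠ 0 := fun h => htM (h ▸ A.nonunits.zero_mem)
  have hdefP : CoordDefinableSet K {x | 1 + x ∈ S} := hdef.mem (.add (.const 1) (.proj 0))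
  refine exists_definable_of_minimal (p := p) (C := {0, 1, -1, t, t⁻¹, t - 1}) hA hdefP (by simp)
    hAS ?_ (by simp) (by simp) (s := t - 1) (by simp) (by simpa using htS) hmin ?_ ?_
  · rintro x (rfl | rfl | rfl | rfl | rfl | rfl)
    · exact A.zero_mem
    · exact A.one_mem
    · exact A.neg_mem _ A.one_mem
    · exact htA
    · exact A.inv_mem_of_notMem_nonunits htM
    · exact sub_mem htA A.one_mem
  · intro x
    by_contra! h
    set C : Set L := {0, 1, -1, t, t⁻¹, t - 1} with hC
    obtain ⟨hx, hx'⟩ := h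
    have h0 : (0 : L) ∈ C := by simp [hC]
    have hx0 : x ≠ 0 := fun h => hx (h ▸ boundedSets.zero_mem h0 2)
    have key : ∀ z, z ∉ boundedSets {x | 1 + x ∈ S} C 2 → ∀ c ∈ C, 1 + z⁻¹ * c ∈ S := by
      intro z hz c hc
      refine (boundedSets.absorb_or_inv_mem (P := {x | 1 + x ∈ S}) h0
        (by simpa using hS.one_mem) z⁻¹ 0).resolve_right
        (fun h => ?_) c (boundedSets.mem_of_mem_const h0 hc 0)
      rw [inv_inv] at h
      exact hz (boundedSets.subset_succ h0 1 h)
    -- `1 + x * c = (x * c) * (1 + x⁻¹ * c⁻¹)` has both sums in `S`. Comparing `c = 1` with `c = t`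
    -- then forces `t ∈ S`.
    have key2 : ∀ c ∈ C, c⁻¹ ∈ C → c ≠ 0 → x * c ∈ S := by
      intro c hc hc' hc0
      have h1 := key _ hx c⁻¹ hc'
      have h2 := key _ hx' c hc
      rw [inv_inv] at h2
      rw [show 1 + x * c = (x * c) * (1 + x⁻¹ * c⁻¹) by field_simp; ring,
        hS.mul_mem_iff_left h1] at h2
      exact h2
    have h1 := key2 1 (by simp [hC]) (by simp [hC]) one_ne_zero
    have h2 := key2 t (by simp [hC]) (by simp [hC]) ht0
    rw [mul_one] at h1
    exact htS ((hS.mul_mem_iff_right h1).1 h2)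
  · intro O d hd0 hd
    -- Were `a⁻¹ ∈ O`, the choice `y = -a⁻¹` would put `0` in `S`.
    have hneg : ∀ a : L, a ≠ 0 → (∀ y ∈ O, 1 + a * y ∈ S) → a ∈ O.nonunits := by
      intro a ha0 ha
      by_contra h
      have := ha _ (O.neg_mem _ (O.inv_mem_of_notMem_nonunits h))
      rw [mul_neg, mul_inv_cancel₀ ha0, add_neg_cancel] at this
      exact hS.zero_notMem this
    have hneg' : ∀ a : L, (∀ y ∈ O, 1 + a * y ∈ S) → a ∈ O.nonunits := fun a ha => by
      by_cases ha0 : a = 0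
      · exact ha0 ▸ O.nonunits.zero_mem
      · exact hneg a ha0 ha
    -- `q` lies in the prime field, so its inverse is a power of it.
    have hqinv : (q : L)⁻¹ ∈ O := by
      have h1 : (q : L) ^ p = q := by
        rw [← frobenius_def, map_natCast]
      have h2 : (q : L)⁻¹ = (q : L) ^ (p - 2) := by
        refine inv_eq_of_mul_eq_one_right (mul_right_cancel₀ hq ?_)
        rw [← pow_succ', ← pow_succ, one_mul, show p - 2 + 1 + 1 = p by have := hp.two_le; omega, h1]
      rw [h2]
      exact O.pow_mem (natCast_mem O q) _
    let I : Ideal O :=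
      { carrier := {x | ∀ y ∈ O, 1 + (x : L) * y ∈ S}
        zero_mem' := fun y _ => by simpa using hS.one_mem
        add_mem' := fun {a b} ha hb y hy => by
          have hM : (a : L) * y ∈ O.nonunits := by
            rw [mul_comm]
            exact O.mul_mem_nonunits hy (hneg' _ ha)
          have h0 := O.one_add_ne_zero hM
          have h1 := hS.mul_mem (ha y hy) (hb _ (O.mul_mem _ _ hy (O.inv_one_add_mem hM)))
          rwa [show (1 + (a : L) * y) * (1 + (b : L) * (y * (1 + (a : L) * y)⁻¹)) =
            1 + ((a : L) + b) * y by field_simp; ring] at h1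
        smul_mem' := fun c a ha y hy => by
          rw [smul_eq_mul, Subring.coe_mul, mul_comm (c : L), mul_assoc]
          exact ha _ (O.mul_mem _ _ c.2 hy) }
    have hI : I ≠ ⊤ := fun h => O.one_notMem_nonunits
      (hneg' 1 ((Ideal.eq_top_iff_one I).1 h))
    have hdM : d ∈ O.nonunits := hneg' d hd
    -- With `r = y / q`, the `q`-th power `(1 + x * r) ^ q` equals `1 + x * y` up to a multiple of
    -- `x ^ 2`; the error is corrected by a factor in `S` because `x ^ 2 ∈ I`.
    obtain ⟨O', hO, hO'⟩ := O.exists_nonunits_eq_ideal I hI (fun x hx y hy => by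
      have hxM : (x : L) ∈ O.nonunits :=
        O.mem_nonunits_of_pow_mem two_ne_zero (hneg' _ hx)
      let r : O := ⟨(q : L)⁻¹ * y, O.mul_mem _ _ hqinv hy⟩
      obtain ⟨k, hk⟩ := Polynomial.powAddExpansion (1 : O) (x * r) q
      have hu : (x : L) * r ∈ O.nonunits := by
        rw [mul_comm]
        exact O.mul_mem_nonunits r.2 hxM
      have h0 := O.one_add_ne_zero hu
      have h2 : 1 + (x : L) ^ 2 * (-((k : L) * (r : L) ^ 2) * ((1 + (x : L) * r)⁻¹) ^ q) ∈ S :=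
        hx _ (O.mul_mem _ _ (O.neg_mem _ (O.mul_mem _ _ k.2 (O.pow_mem r.2 2)))
        (O.pow_mem (O.inv_one_add_mem hu) q))
      have h3 := hS.mul_mem (hSq _ h0) h2
      have hqr : (q : L) * r = y := mul_inv_cancel_left₀ hq y
      have hk' := congrArg O.subtype hk
      simp only [map_add, map_mul, map_pow, map_one, map_natCast, one_pow, mul_one,
        ValuationSubring.subtype_apply] at hk'
      have hk'' : (1 + (x : L) * r) ^ q = 1 + (x : L) * y + k * ((x : L) * r) ^ 2 := by
        rw [hk', ← hqr]
        ring
      have h4 : (1 + (x : L) * r) ^ q * (1 + (x : L) ^ 2 *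
          (-((k : L) * (r : L) ^ 2) * ((1 + (x : L) * r)⁻¹) ^ q)) = 1 + (x : L) * y := by
        rw [inv_pow]
        have := pow_ne_zero q h0
        generalize (1 + (x : L) * r) ^ q = g at *
        field_simp
        rw [hk'']
        ring
      rwa [h4] at h3)
    refine ⟨O', hO, fun x hx => ?_, Or.inr ((hO' d).2 ⟨O.mem_of_mem_nonunits hdM, hd⟩)⟩
    obtain ⟨hxO, hxI⟩ := (hO' x).1 hx
    simpa using hxI 1 O.one_mem

end FromNonunits

/-! ### From defects of a valuation to definable rings -/

section FinitePowerIndices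

variable {K L : Type*} [Field K] [Field L] [Algebra K L] [FiniteDimensional K L]

theorem ValuationSubring.infinite_of_ne_top {A : ValuationSubring L} (hA : A ≠ ⊤) : Infinite L := by
  by_contra h
  rw [not_infinite_iff_finite] at h
  obtain ⟨x, hx⟩ := exists_notMem_of_ne_top hA
  have hx0 : x ≠ 0 := fun h => hx (h ▸ A.zero_mem)
  have := orderOf_pos (Units.mk0 x hx0)
  refine hx (A.mem_of_pow_mem this.ne' ?_)
  have h1 := congrArg Units.val (pow_orderOf_eq_one (Units.mk0 x hx0))
  simp only [Units.val_pow_eq_pow_val, Units.val_mk0, Units.val_one] at h1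
  rw [h1]
  exact A.one_mem

/-- If `x` had no `p`-th root, two of the infinitely many elements `x + c ^ p` would share a coset
of the `p`-th powers. Additivity of Frobenius then allows solving for `x` as a `p`-th power. -/
theorem exists_pow_char_eq_of_finiteIndex {p : ℕ} [Fact p.Prime] [CharP L p] [Infinite L]
    (hfin : (powMonoidHom p : Lˣ →* Lˣ).range.FiniteIndex) (x : L) : ∃ y, y ^ p = x := by
  by_contra! hx
  have hne : ∀ c : L, x + c ^ p ≠ 0 := fun c hc => hx (0 - c) (by
    rw [sub_pow_char, zero_pow (Fact.out : p.Prime).ne_zero]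
    linear_combination -hc)
  have : Finite (Lˣ ⧸ (powMonoidHom p : Lˣ →* Lˣ).range) := inferInstance
  obtain ⟨c, c', hcc', h⟩ := Finite.exists_ne_map_eq_of_infinite
    (fun c : L => (Units.mk0 _ (hne c) : Lˣ ⧸ (powMonoidHom p : Lˣ →* Lˣ).range))
  obtain ⟨y, hy⟩ := QuotientGroup.eq.1 h
  have hy' := congrArg (fun u : Lˣ => ((Units.mk0 _ (hne c) * u : Lˣ) : L)) hy
  simp only [powMonoidHom_apply, mul_inv_cancel_left, Units.val_mul, Units.val_mk0,
    Units.val_pow_eq_pow_val] at hy'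
  have key : x * (1 - (y : L)) ^ p = (y * c - c') ^ p * 1 := by
    rw [sub_pow_char, sub_pow_char, mul_pow, one_pow]
    linear_combination -hy'
  by_cases hy1 : (1 : L) - y = 0
  · rw [hy1, zero_pow (Fact.out : p.Prime).ne_zero, mul_zero, mul_one] at key
    have := pow_eq_zero_iff (Fact.out : p.Prime).ne_zero |>.1 key.symm
    rw [← sub_eq_zero.1 hy1, one_mul] at this
    exact hcc' (sub_eq_zero.1 this)
  · refine hx ((y * c - c') / (1 - y)) ?_
    rw [div_pow, div_eq_iff (pow_ne_zero p hy1), key, mul_one]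

theorem Subgroup.exists_notMem_image_of_ne_top {T : Subgroup Lˣ} {u : Lˣ} (hu : u ∉ T) :
    ∃ z : L, z ≠ 0 ∧ z ∉ ((↑) '' (T : Set Lˣ) : Set L) :=
  ⟨u, u.ne_zero, by
    rintro ⟨v, hv, h⟩
    exact hu (Units.ext h ▸ hv)⟩

theorem exists_definable_of_value_not_pow (hL : FinitePowerIndices L) (A : ValuationSubring L)
    {n : ℕ} (hn : 0 < n) {x : L} (hx0 : x ≠ 0)
    (hx : ∀ y, A.valuation x ≠ A.valuation y ^ n) :
    ∃ R : ValuationSubring L, R ≠ ⊤ ∧ CoordDefinableSet K (R : Set L) := by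
  set T := (powMonoidHom n : Lˣ →* Lˣ).range ⊔ A.unitGroup with hT
  have hxT : Units.mk0 x hx0 ∉ T := by
    rw [hT, Subgroup.mem_sup]
    rintro ⟨_, ⟨y, rfl⟩, u, hu, h⟩
    refine hx y ?_
    have := congrArg (fun u : Lˣ => A.valuation u) h
    rw [ValuationSubring.mem_unitGroup_iff] at hu
    simpa [hu] using this.symm
  refine exists_definable_of_units_subset A T.isMulSubgroup_image
    (.of_powers_le (hL.1 n hn) le_sup_left) (fun u huA huM => ?_)
    (Subgroup.exists_notMem_image_of_ne_top hxT)
  have hu0 : u ≠ 0 := fun h => huM (h ▸ A.nonunits.zero_mem)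
  refine ⟨Units.mk0 u hu0, (le_sup_right : A.unitGroup ≤ T) ?_, rfl⟩
  rw [ValuationSubring.mem_unitGroup_iff]
  exact le_antisymm ((A.valuation_le_one_iff u).2 huA)
    (not_lt.1 fun h => huM (A.mem_nonunits_iff.2 h))


theorem exists_definable_of_residue_not_pow (p : ℕ) [Fact p.Prime] [CharP L p]
    (hL : FinitePowerIndices L) {A : ValuationSubring L}
    (hA : A ≠ ⊤) {q : ℕ} (hq : (q : L) ≠ 0)
    {x : IsLocalRing.ResidueField A} (hx : ∀ y, y ^ q ≠ x) :
    ∃ R : ValuationSubring L, R ≠ ⊤ ∧ CoordDefinableSet K (R : Set L) := by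
  have hq0 : 0 < q := Nat.pos_of_ne_zero fun h => hq (by simp [h])
  obtain ⟨u, rfl⟩ := IsLocalRing.residue_surjective x
  set T := (powMonoidHom q : Lˣ →* Lˣ).range ⊔ A.principalUnitGroup with hT
  have hu0 : (u : L) ≠ 0 := by
    intro h
    have : u = 0 := Subtype.ext h
    exact hx 0 (by rw [this, map_zero, zero_pow hq0.ne'])
  have hxT : Units.mk0 (u : L) hu0 ∉ T := by
    rw [hT, Subgroup.mem_sup]
    rintro ⟨_, ⟨y, rfl⟩, m, hm, h⟩
    rw [ValuationSubring.mem_principalUnitGroup_iff] at hm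
    have h' : (y : L) ^ q * m = u := by
      have := congrArg Units.val h
      simpa using this
    have hmA : (m : L) ∈ A := by
      have := A.one_add_mem_of_mem_nonunits (A.mem_nonunits_iff.2 hm)
      simpa using this
    have hminv : (m : L)⁻¹ ∈ A := by
      have := A.inv_one_add_mem (A.mem_nonunits_iff.2 hm)
      simpa using this
    have hyA : (y : L) ∈ A := by
      refine A.mem_of_pow_mem hq0.ne' ?_
      rw [(eq_mul_inv_iff_mul_eq₀ m.ne_zero).2 h']
      exact A.mul_mem _ _ u.2 hminv
    refine hx (IsLocalRing.residue A ⟨y, hyA⟩) ?_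
    have hm1 : IsLocalRing.residue A ⟨m, hmA⟩ = 1 := by
      rw [← sub_eq_zero, ← map_one (IsLocalRing.residue A), ← map_sub,
        IsLocalRing.residue_eq_zero_iff, ValuationSubring.valuation_lt_one_iff]
      exact hm
    have : (⟨y, hyA⟩ : A) ^ q * ⟨m, hmA⟩ = u := Subtype.ext h'
    rw [← this, map_mul, hm1, mul_one, map_pow]
  refine exists_definable_of_nonunits_subset_mulSubgroup p hq hA T.isMulSubgroup_image
    (.of_powers_le (hL.1 q hq0) le_sup_left) (fun x hx0 => ?_) (fun x hx => ?_)
    (Subgroup.exists_notMem_image_of_ne_top hxT)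
  · exact ⟨Units.mk0 x hx0 ^ q, (le_sup_left : _ ≤ T) ⟨Units.mk0 x hx0, rfl⟩, by simp⟩
  · refine ⟨Units.mk0 _ (A.one_add_ne_zero hx), (le_sup_right : _ ≤ T) ?_, rfl⟩
    rw [ValuationSubring.mem_principalUnitGroup_iff]
    simpa using A.mem_nonunits_iff.1 hx

theorem exists_definable_of_residue_not_artinSchreier (p : ℕ) [Fact p.Prime] [CharP L p]
    (hL : FinitePowerIndices L)
    {A : ValuationSubring L} (hA : A ≠ ⊤)
    {x : IsLocalRing.ResidueField A} (hx : ∀ y, y ^ p - y ≠ x) :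
    ∃ R : ValuationSubring L, R ≠ ⊤ ∧ CoordDefinableSet K (R : Set L) := by
  have hp := (Fact.out : p.Prime)
  have := A.infinite_of_ne_top hA
  obtain ⟨u, rfl⟩ := IsLocalRing.residue_surjective x
  let M : AddSubgroup L := A.nonunits.toAddSubgroup
  have hperf := exists_pow_char_eq_of_finiteIndex (hL.1 p hp.pos)
  refine exists_definable_of_nonunits_subset_addSubgroup hperf hA
    (T := (artinSchreierHom L p).range ⊔ M) (.of_artinSchreier_le (hL.2 p) le_sup_left) le_sup_left
    (fun x hx => (le_sup_right : M ≤ _) hx) ⟨u, ?_⟩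
  rw [AddSubgroup.mem_sup]
  rintro ⟨_, ⟨y, rfl⟩, m, hm, h⟩
  have hm : m ∈ A.nonunits := hm
  have h : y ^ p - y + m = u := h
  have hyA : y ∈ A := by
    by_contra hy
    have hy0 : y ≠ 0 := fun h => hy (h ▸ A.zero_mem)
    have h1 : y ^ p - y ∈ A := by
      rw [eq_sub_of_add_eq h]
      exact sub_mem u.2 (A.mem_of_mem_nonunits hm)
    -- If `y` has a pole, the left side lies in the maximal ideal while the right side is `1` modulo
    -- it.
    have h2 : (y⁻¹) ^ p * (y ^ p - y) = 1 - (y⁻¹) ^ (p - 1) := by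
      obtain ⟨k, rfl⟩ := Nat.exists_eq_add_of_lt hp.pos
      simp only [zero_add, Nat.add_sub_cancel, inv_pow]
      field_simp
      ring
    have hyM := A.inv_mem_nonunits_of_notMem hy
    have hpow : ∀ k : ℕ, k ≠ 0 → (y⁻¹) ^ k ∈ A.nonunits := by
      intro k hk
      obtain ⟨j, rfl⟩ := Nat.exists_eq_succ_of_ne_zero hk
      rw [pow_succ]
      exact A.mul_mem_nonunits (A.pow_mem (A.mem_of_mem_nonunits hyM) j) hyM
    have h3 := A.mul_mem_nonunits h1 (hpow p hp.ne_zero)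
    rw [mul_comm, h2] at h3
    have h4 := add_mem h3 (hpow (p - 1) (by have := hp.two_le; omega))
    rw [sub_add_cancel] at h4
    exact A.one_notMem_nonunits h4
  refine hx (IsLocalRing.residue A ⟨y, hyA⟩) ?_
  have hmA := A.mem_of_mem_nonunits hm
  have hm0 : IsLocalRing.residue A ⟨m, hmA⟩ = 0 := by
    rw [IsLocalRing.residue_eq_zero_iff, ValuationSubring.valuation_lt_one_iff]
    exact A.mem_nonunits_iff.1 hm
  have : (⟨y, hyA⟩ : A) ^ p - ⟨y, hyA⟩ + ⟨m, hmA⟩ = u := Subtype.ext h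
  rw [← this, map_add, hm0, add_zero, map_sub, map_pow]

end FinitePowerIndices

/-! ### Restriction to the base field -/

section Descent

variable {K L : Type*} [Field K] [Field L] [Algebra K L] [FiniteDimensional K L]

/-- If `R` contained `K`, it would contain the integral closure of `K`, which is `L`. -/
theorem ValuationSubring.comap_ne_top {R : ValuationSubring L} (hR : R ≠ ⊤) :
    R.comap (algebraMap K L) ≠ ⊤ := by
  intro h
  obtain ⟨x, hx⟩ := exists_notMem_of_ne_top hR
  have hint : IsIntegral K x := Algebra.IsIntegral.isIntegral x
  have hK : ∀ a : K, algebraMap K L a ∈ R := fun a => by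
    have : a ∈ R.comap (algebraMap K L) := h ▸ mem_top a
    exact this
  obtain ⟨f, hf, hfx⟩ := hint
  have : IsIntegral R x := by
    refine ⟨f.map ((algebraMap K L).codRestrict R.toSubring hK), hf.map _, ?_⟩
    rw [Polynomial.eval₂_map]
    exact hfx
  obtain ⟨y, hy⟩ := IsIntegrallyClosed.isIntegral_iff.1 this
  exact hx (hy ▸ y.2)

theorem CoordDefinableSet.definable_comap {R : ValuationSubring L}
    (h : CoordDefinableSet K (R : Set L)) :
    IsDefinableValuation (R.comap (algebraMap K L)).valuation := by
  have h1 : FieldDefinable (fun c : Fin 1 → K => algebraMap K L (c 0) ∈ R) := by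
    have := FieldDefinable.comp (α := Fin 1) h
      (f := fun i c => (Module.finBasis K L).repr (algebraMap K L (c 0)) i.2) (fun i => by
        simp only [Algebra.algebraMap_eq_smul_one, map_smul, Finsupp.smul_apply, smul_eq_mul]
        exact (IsRingTermFun.proj 0).mul (.const _))
    convert this using 2 with c
    have h2 := congrFun (ofCoords_toCoords K (fun _ : Fin 1 => algebraMap K L (c 0))) 0
    exact iff_of_eq (congrArg (· ∈ R) h2).symm
  unfold IsDefinableValuation Set.Definable₁
  unfold FieldDefinable at h1
  convert h1 using 3 with c
  simp [ValuationSubring.valuation_le_one_iff]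

theorem exists_definable_valuation {K : Type u} [Field K] [Algebra K L] [FiniteDimensional K L]
    (h : ∃ R : ValuationSubring L, R ≠ ⊤ ∧ CoordDefinableSet K (R : Set L)) :
    ∃ (Γ₀ : Type u) (_ : LinearOrderedCommGroupWithZero Γ₀) (v : Valuation K Γ₀),
      Function.Surjective v ∧ v.IsNontrivial ∧ IsDefinableValuation v := by
  obtain ⟨R, hR, hdef⟩ := h
  refine ⟨_, inferInstance, (R.comap (algebraMap K L)).valuation,
    ValuationSubring.valuation_surjective _, ?_, hdef.definable_comap⟩
  by_contra hnt
  exact R.comap_ne_top hR ((ValuationSubring.eq_top_iff _).2 hnt)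

end Descent

/-! ### Cyclic extensions of prime degree and algebraic closedness -/

section CyclicExtensions

/-- An Artin–Schreier theorem: a Galois extension of degree `p` in characteristic `p` comes from
an element which is not of the form `y ^ p - y`. -/
theorem exists_ne_artinSchreier_of_finrank_eq (p : ℕ) [Fact p.Prime] (F E : Type*) [Field F]
    [Field E] [Algebra F E] [CharP F p] [FiniteDimensional F E] [IsGalois F E]
    (hd : Module.finrank F E = p) : ∃ x : F, ∀ y, y ^ p - y ≠ x := by
  have hp := (Fact.out : p.Prime)
  have : CharP E p := charP_of_injective_algebraMap (algebraMap F E).injective p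
  have : CharP (Module.End F E) p :=
    charP_of_injective_algebraMap (algebraMap F (Module.End F E)).injective p
  have hcard : Nat.card Gal(E/F) = p := by rw [IsGalois.card_aut_eq_finrank, hd]
  have hcyc := isCyclic_of_prime_card hcard
  obtain ⟨σ, hσ⟩ := hcyc
  have hfix : ∀ x : E, σ x = x → ∃ a : F, algebraMap F E a = x := by
    intro x hx
    rw [← Set.mem_range, ← IntermediateField.mem_bot, IsGalois.mem_bot_iff_fixed]
    intro τ
    obtain ⟨n, rfl⟩ := Subgroup.mem_zpowers_iff.1 (hσ τ)
    have : σ ∈ MulAction.stabilizer Gal(E/F) x := hx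
    exact Subgroup.zpow_mem _ this n
  -- `D` is nilpotent since `D ^ p = σ ^ p - 1 = 0`. An element killed by `D ^ 2` but not by `D`,
  -- divided by its image, yields `θ` with `σ θ = θ + 1`.
  set D : Module.End F E := σ.toLinearMap - 1 with hD
  have hD0 : D ≠ 0 := by
    intro h
    have h1 : σ = 1 := AlgEquiv.ext fun x => by
      have := LinearMap.congr_fun h x
      exact sub_eq_zero.1 this
    have h2 : Nat.card Gal(E/F) = 1 := by
      rw [Nat.card_eq_one_iff_unique]
      refine ⟨⟨fun a b => ?_⟩, ⟨1⟩⟩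
      obtain ⟨n, rfl⟩ := Subgroup.mem_zpowers_iff.1 (hσ a)
      obtain ⟨m, rfl⟩ := Subgroup.mem_zpowers_iff.1 (hσ b)
      simp [h1]
    rw [hcard] at h2
    exact hp.one_lt.ne' h2
  have hDp : D ^ p = 0 := by
    rw [hD, sub_pow_char_of_commute _ (Commute.one_right _), one_pow, ← AlgEquiv.pow_toLinearMap,
      ← hcard, pow_card_eq_one']
    exact sub_self _
  obtain ⟨θ₁, h1, h2⟩ : ∃ θ, D θ ≠ 0 ∧ D (D θ) = 0 := by
    classical
    have hex : ∃ n, D ^ n = 0 := ⟨p, hDp⟩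
    have hn0 : Nat.find hex ≠ 0 := fun h => by
      have := Nat.find_spec hex
      rw [h, pow_zero] at this
      exact one_ne_zero this
    have hn1 : Nat.find hex ≠ 1 := fun h => by
      have := Nat.find_spec hex
      rw [h, pow_one] at this
      exact hD0 this
    obtain ⟨m, hm⟩ : ∃ m, Nat.find hex = m + 2 := ⟨Nat.find hex - 2, by omega⟩
    have hlt : D ^ (m + 1) ≠ 0 := Nat.find_min hex (by omega)
    obtain ⟨v, hv⟩ := DFunLike.ne_iff.1 hlt
    refine ⟨(D ^ m) v, ?_, ?_⟩
    · rwa [pow_succ'] at hv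
    · have := LinearMap.congr_fun (Nat.find_spec hex) v
      rwa [hm, pow_succ', pow_succ'] at this
  have hDσ : ∀ x, σ x = x + D x := fun x => by simp [hD]
  obtain ⟨a, ha⟩ := hfix (D θ₁) (by rw [hDσ, h2, add_zero])
  set θ : E := θ₁ / D θ₁ with hθ
  have hσθ : σ θ = θ + 1 := by
    rw [hθ, map_div₀, hDσ (D θ₁), h2, add_zero, hDσ θ₁, add_div, div_self h1]
  obtain ⟨x, hx⟩ := hfix (θ ^ p - θ) (by
    rw [map_sub, map_pow, hσθ, add_pow_char, one_pow]
    ring)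
  refine ⟨x, fun y hy => ?_⟩
  -- Two Artin–Schreier roots differ by an element of the prime field, which would put `θ` in `F`.
  have h3 : (θ - algebraMap F E y) ^ p = θ - algebraMap F E y := by
    rw [sub_pow_char]
    have := congrArg (algebraMap F E) hy
    rw [hx, map_sub, map_pow] at this
    linear_combination -this
  rw [← Subfield.mem_bot_iff_pow_eq_self E p] at h3
  have h4 : (⊥ : Subfield E) ≤ ((⊥ : IntermediateField F E)).toSubfield := bot_le
  obtain ⟨b, hb⟩ := IntermediateField.mem_bot.1 (h4 h3)
  have h5 : θ = algebraMap F E (b + y) := by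
    rw [map_add, hb, sub_add_cancel]
  rw [h5, AlgEquiv.commutes] at hσθ
  exact one_ne_zero (left_eq_add.1 hσθ)

theorem exists_ne_pow_of_finrank_eq {q : ℕ} (hq : q.Prime) (F E : Type*) [Field F]
    [Field E] [Algebra F E] [FiniteDimensional F E] [IsGalois F E]
    (hd : Module.finrank F E = q) {ζ : F} (hζ : IsPrimitiveRoot ζ q) :
    ∃ x : F, ∀ y, y ^ q ≠ x := by
  have : Fact q.Prime := ⟨hq⟩
  have : IsCyclic Gal(E/F) := isCyclic_of_prime_card (p := q) (by
    rw [IsGalois.card_aut_eq_finrank, hd])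
  obtain ⟨α, ⟨x, hx⟩, hα⟩ := exists_root_adjoin_eq_top_of_isCyclic F E
    ⟨ζ, (mem_primitiveRoots Module.finrank_pos).2 (hd.symm ▸ hζ)⟩
  rw [hd] at hx
  refine ⟨x, fun y hy => ?_⟩
  have hmem : α ∈ (⊥ : IntermediateField F E) := by
    by_cases hy0 : y = 0
    · rw [← hy, hy0, zero_pow hq.ne_zero, map_zero] at hx
      rw [(pow_eq_zero_iff hq.ne_zero).1 hx.symm]
      exact zero_mem _
    · have hy0' : algebraMap F E y ≠ 0 := by simpa using hy0
      have h1 : (α / algebraMap F E y) ^ q = 1 := by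
        rw [div_pow, ← hx, ← map_pow, hy, div_self]
        rw [← hy, map_pow]
        exact pow_ne_zero q hy0'
      have : NeZero q := ⟨hq.ne_zero⟩
      obtain ⟨i, -, hi⟩ := (hζ.map_of_injective (algebraMap F E).injective).eq_pow_of_pow_eq_one h1
      rw [eq_div_iff hy0', ← map_pow, ← map_mul] at hi
      exact IntermediateField.mem_bot.2 ⟨_, hi⟩
  rw [IntermediateField.adjoin_simple_eq_bot_iff.2 hmem] at hα
  have := IntermediateField.finrank_top' (F := F) (E := E)
  rw [← hα, IntermediateField.finrank_bot, hd] at this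
  exact hq.one_lt.ne this

theorem exists_intermediateField_finrank_eq_of_prime_dvd {F E : Type*} [Field F] [Field E]
    [Algebra F E] [FiniteDimensional F E] [IsGalois F E] {r : ℕ} (hr : r.Prime)
    (h : r ∣ Module.finrank F E) : ∃ F' : IntermediateField F E, Module.finrank F' E = r := by
  have : Fact r.Prime := ⟨hr⟩
  rw [← IsGalois.card_aut_eq_finrank] at h
  obtain ⟨σ, hσ⟩ := exists_prime_orderOf_dvd_card' r h
  refine ⟨IntermediateField.fixedField (Subgroup.zpowers σ), ?_⟩
  rw [IntermediateField.finrank_fixedField_eq_card, Nat.card_zpowers, hσ]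

/-- A field has all `q`-th roots for primes `q ≠ p` and all Artin–Schreier roots. -/
def IsRootClosed (p : ℕ) (F : Type*) [Field F] : Prop :=
  (∀ q : ℕ, q.Prime → q ≠ p → ∀ x : F, ∃ y, y ^ q = x) ∧ ∀ x : F, ∃ y, y ^ p - y = x

theorem IsRootClosed.of_ringEquiv {p : ℕ} {F F' : Type*} [Field F] [Field F'] (e : F ≃+* F')
    (h : IsRootClosed p F) : IsRootClosed p F' := by
  refine ⟨fun q hq hqp x => ?_, fun x => ?_⟩
  · obtain ⟨y, hy⟩ := h.1 q hq hqp (e.symm x)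
    exact ⟨e y, by rw [← map_pow, hy, e.apply_symm_apply]⟩
  · obtain ⟨y, hy⟩ := h.2 (e.symm x)
    exact ⟨e y, by rw [← map_pow, ← map_sub, hy, e.apply_symm_apply]⟩

/-- All finite extensions of the field are root closed. -/
def IsHereditarilyRootClosed (p : ℕ) (k : Type u) [Field k] : Prop :=
  ∀ (F : Type u) [Field F] [Algebra k F] [FiniteDimensional k F], IsRootClosed p F

theorem IsHereditarilyRootClosed.of_finite {p : ℕ} {k F : Type u} [Field k] [Field F] [Algebra k F]
    [FiniteDimensional k F] (h : IsHereditarilyRootClosed p k) : IsHereditarilyRootClosed p F := by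
  intro E _ _ _
  let _ : Algebra k E := ((algebraMap F E).comp (algebraMap k F)).toAlgebra
  have : IsScalarTower k F E := .of_algebraMap_eq fun _ => rfl
  have : FiniteDimensional k E := .trans k F E
  exact h E

/-- Strong induction on `q`. Kummer theory needs a primitive `q`-th root of unity; adjoining it has
degree below `q`, and a prime factor of that degree would be the degree of a smaller Galois
extension, so the root is already in `F`. -/
theorem IsHereditarilyRootClosed.finrank_ne_prime {p : ℕ} [Fact p.Prime] {q : ℕ} (hq : q.Prime) :
    ∀ {F : Type u} [Field F] [CharP F p], IsHereditarilyRootClosed p F →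
      ∀ (E : Type u) [Field E] [Algebra F E] [FiniteDimensional F E] [IsGalois F E],
        Module.finrank F E ≠ q := by
  induction q using Nat.strong_induction_on with
  | _ q ih =>
  intro F _ _ hF E _ _ _ _ hd
  by_cases hqp : q = p
  · subst hqp
    obtain ⟨x, hx⟩ := exists_ne_artinSchreier_of_finrank_eq q F E hd
    obtain ⟨y, hy⟩ := (hF F).2 x
    exact hx y hy
  have hqF : (q : F) ≠ 0 := fun h => by
    rw [CharP.cast_eq_zero_iff F p] at h
    exact hqp ((Nat.prime_dvd_prime_iff_eq Fact.out hq).1 h).symm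
  have : NeZero q := ⟨hq.ne_zero⟩
  have : NeZero (q : F) := ⟨hqF⟩
  let C := CyclotomicField q F
  have : IsGalois F C := IsCyclotomicExtension.isGalois {q} F C
  have : FiniteDimensional F C := IsCyclotomicExtension.finiteDimensional {q} F C
  have hζ := IsCyclotomicExtension.zeta_spec q F C
  have hlt : Module.finrank F C < q := by
    rw [← IsGalois.card_aut_eq_finrank]
    refine (Nat.card_le_card_of_injective _ (hζ.autToPow_injective (K := F))).trans_lt ?_
    rw [Nat.card_eq_fintype_card, ZMod.card_units_eq_totient, Nat.totient_prime hq]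
    have := hq.one_lt
    omega
  have hone : Module.finrank F C = 1 := by
    by_contra h
    obtain ⟨r, hr, hrd⟩ := Nat.exists_prime_and_dvd h
    obtain ⟨F', hF'⟩ := exists_intermediateField_finrank_eq_of_prime_dvd hr hrd
    have : CharP F' p := charP_of_injective_algebraMap (algebraMap F F').injective p
    exact ih r ((Nat.le_of_dvd Module.finrank_pos hrd).trans_lt hlt) hr
      (hF.of_finite (F := F')) C hF'
  have hbot : IsCyclotomicExtension.zeta q F C ∈ (⊥ : IntermediateField F C) := by
    rw [IntermediateField.bot_eq_top_iff_finrank_eq_one.2 hone]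
    trivial
  obtain ⟨ζ, hζ'⟩ := IntermediateField.mem_bot.1 hbot
  rw [← hζ'] at hζ
  obtain ⟨x, hx⟩ := exists_ne_pow_of_finrank_eq hq F E hd
    (hζ.of_map_of_injective (algebraMap F C).injective)
  obtain ⟨y, hy⟩ := (hF F).1 q hq hqp x
  exact hx y hy

theorem IsHereditarilyRootClosed.isAlgClosed {p : ℕ} [Fact p.Prime] {k : Type u} [Field k]
    [CharP k p] [PerfectField k] (h : IsHereditarilyRootClosed p k) : IsAlgClosed k := by
  refine IsAlgClosed.of_exists_root k fun f hf hirr => ?_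
  let E := f.SplittingField
  have : IsGalois k E := IsGalois.of_separable_splitting_field (p := f)
    (PerfectField.separable_of_irreducible hirr)
  have hone : Module.finrank k E = 1 := by
    by_contra hne
    obtain ⟨r, hr, hrd⟩ := Nat.exists_prime_and_dvd hne
    obtain ⟨F, hF⟩ := exists_intermediateField_finrank_eq_of_prime_dvd hr hrd
    have : CharP F p := charP_of_injective_algebraMap (algebraMap k F).injective p
    exact (h.of_finite (F := F)).finrank_ne_prime hr E hF
  obtain ⟨x, hx⟩ := (Polynomial.SplittingField.splits f).exists_eval_eq_zero
    (by rw [Polynomial.degree_map]; exact hirr.degree_pos.ne')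
  have hbot : x ∈ (⊥ : IntermediateField k E) := by
    rw [IntermediateField.bot_eq_top_iff_finrank_eq_one.2 hone]
    trivial
  obtain ⟨y, rfl⟩ := IntermediateField.mem_bot.1 hbot
  refine ⟨y, (algebraMap k E).injective ?_⟩
  rw [map_zero, ← hx, Polynomial.eval_map_algebraMap, Polynomial.aeval_algebraMap_apply_eq_algebraMap_eval]

end CyclicExtensions

/-! ### Lifting finite extensions of the residue field -/

section ResidueExtensions

open IsLocalRing

/-- Dividing a relation by its coefficient of largest valuation makes it integral with one
coefficient equal to `1`, which survives reduction. -/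
theorem ValuationSubring.linearIndependent_of_residue {K L : Type*} [Field K] [Field L]
    [Algebra K L] (A : ValuationSubring K) (B : ValuationSubring L) (φ : A →+* B) [IsLocalHom φ]
    (hφ : ∀ a : A, (φ a : L) = algebraMap K L a) {ι : Type*} [Fintype ι] {b : ι → B}
    (h : ∀ a : ι → A, ∑ i, φ (a i) * b i ∈ maximalIdeal B → ∀ i, a i ∈ maximalIdeal A) :
    LinearIndependent K (fun i => (b i : L)) := by
  rw [Fintype.linearIndependent_iff]
  intro c hc
  by_contra! hne
  obtain ⟨i₀, hi₀⟩ := hne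
  obtain ⟨j, -, hj⟩ := Finset.exists_max_image Finset.univ (fun i => A.valuation (c i))
    ⟨i₀, Finset.mem_univ _⟩
  have hcj : c j ≠ 0 := by
    intro h0
    have := hj i₀ (Finset.mem_univ _)
    rw [h0, map_zero, le_zero_iff, map_eq_zero] at this
    exact hi₀ this
  have hmem : ∀ i, c i / c j ∈ A := fun i => by
    rw [← A.valuation_le_one_iff, map_div₀]
    exact div_le_one_of_le₀ (hj i (Finset.mem_univ _)) zero_le
  have hsum : ∑ i, φ ⟨c i / c j, hmem i⟩ * b i = 0 := by
    refine Subtype.ext ?_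
    have h1 : ((∑ i, φ ⟨c i / c j, hmem i⟩ * b i : B) : L) =
        (algebraMap K L (c j))⁻¹ * ∑ i, c i • (b i : L) := by
      rw [← B.subtype_apply, map_sum, Finset.mul_sum]
      refine Finset.sum_congr rfl fun i _ => ?_
      rw [map_mul, B.subtype_apply, B.subtype_apply, hφ, Algebra.smul_def, map_div₀]
      ring
    rw [h1, hc, mul_zero]
    rfl
  have h1 := h _ (by rw [hsum]; exact Ideal.zero_mem _) j
  have h2 : (⟨c j / c j, hmem j⟩ : A) = 1 := Subtype.ext (div_self hcj)
  rw [h2] at h1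
  exact (Ideal.ne_top_iff_one _).1 (maximalIdeal.isMaximal A).ne_top h1

theorem ValuationSubring.rank_residueField_le {K L : Type*} [Field K] [Field L]
    [Algebra K L] [FiniteDimensional K L] (A : ValuationSubring K) (B : ValuationSubring L)
    (φ : A →+* B) [IsLocalHom φ] (hφ : ∀ a : A, (φ a : L) = algebraMap K L a)
    [Algebra (ResidueField A) (ResidueField B)]
    (hφ' : algebraMap (ResidueField A) (ResidueField B) = ResidueField.map φ) :
    Module.rank (ResidueField A) (ResidueField B) ≤ Module.finrank K L := by
  refine rank_le fun s hs => ?_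
  choose b hb using residue_surjective (R := B)
  have hli : LinearIndependent K (fun i : s => (b i : L)) := by
    refine A.linearIndependent_of_residue B φ hφ fun a ha i => ?_
    rw [← residue_eq_zero_iff, map_sum] at ha
    rw [← residue_eq_zero_iff]
    refine Fintype.linearIndependent_iff.1 hs (fun i => residue A (a i)) ?_ i
    rw [← ha]
    refine Finset.sum_congr rfl fun i _ => ?_
    rw [map_mul, hb, Algebra.smul_def, hφ', ResidueField.map_residue]
  simpa using hli.fintype_card_le_finrank

/-- Lift the minimal polynomial of a primitive element of `F` to a monic `g` over `A`, adjoin a root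
of `g`, and let `B` dominate `A`. The root reduces to one of the original polynomial, so `F` embeds
in the residue field of `B`, whose degree is at most `[L : K] = [F : ResidueField A]`; hence
equality. -/
theorem ValuationSubring.exists_extension_residueField {K : Type u} [Field K]
    (A : ValuationSubring K) (F : Type u) [Field F] [Algebra (ResidueField A) F]
    [FiniteDimensional (ResidueField A) F] [Algebra.IsSeparable (ResidueField A) F] :
    ∃ (L : Type u) (_ : Field L) (_ : Algebra K L) (_ : FiniteDimensional K L)
      (B : ValuationSubring L), (∀ a : K, a ∈ A ↔ algebraMap K L a ∈ B) ∧
      Nonempty (ResidueField B ≃+* F) := by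
  let pb := Field.powerBasisOfFiniteOfSeparable (ResidueField A) F
  let f := minpoly (ResidueField A) pb.gen
  have hf : f.Monic := minpoly.monic pb.isIntegral_gen
  obtain ⟨g, hgf, hgdeg, hg⟩ := Polynomial.lifts_and_natDegree_eq_and_monic (f := residue A) (p := f)
    (Polynomial.mem_lifts_of_surjective residue_surjective f) hf
  have hgirr : Irreducible g := hg.irreducible_of_irreducible_map (residue A) g
    (hgf ▸ minpoly.irreducible pb.isIntegral_gen)
  let gK := g.map (algebraMap A K)
  have hgK : Irreducible gK := (hg.irreducible_iff_irreducible_map_fraction_map).1 hgirr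
  have : Fact (Irreducible gK) := ⟨hgK⟩
  let L := AdjoinRoot gK
  have hgKm : gK.Monic := hg.map _
  let pbL := AdjoinRoot.powerBasis hgK.ne_zero
  have hfin : FiniteDimensional K L := pbL.finite
  have hrank : Module.finrank K L = Module.finrank (ResidueField A) F := by
    rw [pbL.finrank, AdjoinRoot.powerBasis_dim, pb.finrank, ← pb.natDegree_minpoly,
      hg.natDegree_map, hgdeg]
  obtain ⟨B, hB, hloc⟩ := exists_factor_valuationRing ((algebraMap K L).comp (algebraMap A K))
  let φ : A →+* B := ((algebraMap K L).comp (algebraMap A K)).codRestrict B.toSubring hB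
  have hφ : ∀ a : A, (φ a : L) = algebraMap K L a := fun _ => rfl
  have : IsLocalHom φ := hloc
  refine ⟨L, inferInstance, inferInstance, hfin, B, fun a => ⟨fun ha => hB ⟨a, ha⟩, fun ha => ?_⟩, ?_⟩
  · by_contra h
    have hM := A.inv_mem_nonunits_of_notMem h
    have hu : IsUnit (φ ⟨a⁻¹, A.mem_of_mem_nonunits hM⟩) := by
      refine IsUnit.of_mul_eq_one ⟨algebraMap K L a, ha⟩ (Subtype.ext ?_)
      have ha0 : a ≠ 0 := fun h0 => h (h0 ▸ A.zero_mem)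
      change algebraMap K L a⁻¹ * algebraMap K L a = 1
      rw [← map_mul, inv_mul_cancel₀ ha0, map_one]
    have := (isUnit_of_map_unit φ _ hu)
    exact (A.coe_mem_nonunits_iff (a := ⟨a⁻¹, A.mem_of_mem_nonunits hM⟩)).1 hM this
  let _ : Algebra (ResidueField A) (ResidueField B) := (ResidueField.map φ).toAlgebra
  have hr : (g.eval₂ (B.subtype.comp φ) (AdjoinRoot.root gK)) = 0 := by
    have := AdjoinRoot.eval₂_root gK
    rwa [Polynomial.eval₂_map] at this
  obtain ⟨r, hrB⟩ := IsIntegrallyClosed.isIntegral_iff.1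
    (show IsIntegral B (AdjoinRoot.root gK) from
      ⟨g.map φ, hg.map φ, by rw [Polynomial.eval₂_map]; exact hr⟩)
  have hr' : g.eval₂ φ r = 0 := by
    refine Subtype.val_injective ?_
    have := Polynomial.hom_eval₂ g φ B.subtype r
    exact this.trans ((congrArg (g.eval₂ (B.subtype.comp φ)) hrB).trans hr)
  have hroot : Polynomial.aeval (residue B r) f = 0 := by
    rw [Polynomial.aeval_def, ← hgf, Polynomial.eval₂_map]
    have := Polynomial.hom_eval₂ g φ (residue B) r
    rw [hr', map_zero] at this
    exact this.symm
  let ψ : F →ₐ[ResidueField A] ResidueField B := pb.lift _ hroot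
  have hle := A.rank_residueField_le B φ hφ rfl
  have hfinB : FiniteDimensional (ResidueField A) (ResidueField B) :=
    Module.rank_lt_aleph0_iff.1 (hle.trans_lt (Cardinal.natCast_lt_aleph0))
  have hψ : Function.Injective ψ := ψ.toRingHom.injective
  have heq : Module.finrank (ResidueField A) F = Module.finrank (ResidueField A) (ResidueField B) :=
    le_antisymm (LinearMap.finrank_le_finrank_of_injective (f := ψ.toLinearMap) hψ)
      (hrank ▸ Module.finrank_le_of_rank_le hle)
  have hsurj : Function.Surjective ψ :=
    (LinearMap.injective_iff_surjective_of_finrank_eq_finrank (f := ψ.toLinearMap) heq).1 hψ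
  exact ⟨(RingEquiv.ofBijective ψ ⟨hψ, hsurj⟩).symm⟩

end ResidueExtensions

/-! ### Conclusion -/

theorem perfectField_residueField {K : Type*} [Field K] {p : ℕ} [Fact p.Prime] [CharP K p]
    (hperf : ∀ x : K, ∃ y, y ^ p = x) (A : ValuationSubring K)
    [CharP (IsLocalRing.ResidueField A) p] : PerfectField (IsLocalRing.ResidueField A) := by
  have : PerfectRing (IsLocalRing.ResidueField A) p := .ofSurjective _ _ fun x => by
    obtain ⟨u, rfl⟩ := IsLocalRing.residue_surjective x
    obtain ⟨y, hy⟩ := hperf u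
    have hyA : y ∈ A := A.mem_of_pow_mem (Fact.out : p.Prime).ne_zero (hy ▸ u.2)
    refine ⟨IsLocalRing.residue A ⟨y, hyA⟩, ?_⟩
    rw [frobenius_def, ← map_pow]
    exact congrArg _ (Subtype.ext hy)
  exact PerfectRing.toPerfectField _ p

theorem isAlgClosed_residueField_of_not_definable {K : Type u} [Field K]
    (hK : ∀ (L : Type u) [Field L] [Algebra K L] [FiniteDimensional K L], FinitePowerIndices L)
    (hnd : ∀ (L : Type u) [Field L] [Algebra K L] [FiniteDimensional K L],
      ¬ ∃ R : ValuationSubring L, R ≠ ⊤ ∧ CoordDefinableSet K (R : Set L))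
    (p : ℕ) [Fact p.Prime] [CharP K p] {A : ValuationSubring K} (hA : A ≠ ⊤) :
    IsAlgClosed (IsLocalRing.ResidueField A) := by
  have hp := (Fact.out : p.Prime)
  have := A.infinite_of_ne_top hA
  have : CharP (IsLocalRing.ResidueField A) p := by
    rw [CharP.charP_iff_prime_eq_zero hp, ← map_natCast (IsLocalRing.residue A)]
    have : (p : A) = 0 := Subtype.ext (by simp)
    rw [this, map_zero]
  have := perfectField_residueField
    (exists_pow_char_eq_of_finiteIndex ((hK K).1 p hp.pos)) A
  refine IsHereditarilyRootClosed.isAlgClosed (p := p) fun F _ _ _ => ?_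
  obtain ⟨L, _, _, _, B, hB, ⟨e⟩⟩ := A.exists_extension_residueField F
  have hBtop : B ≠ ⊤ := by
    obtain ⟨x, hx⟩ := ValuationSubring.exists_notMem_of_ne_top hA
    exact ValuationSubring.ne_top_of_notMem fun h => hx ((hB x).2 h)
  have : CharP L p := charP_of_injective_algebraMap (algebraMap K L).injective p
  refine IsRootClosed.of_ringEquiv e ⟨fun q hq hqp x => ?_, fun x => ?_⟩
  · by_contra! h
    have hqL : (q : L) ≠ 0 := fun h => by
      rw [CharP.cast_eq_zero_iff L p] at h
      exact hqp ((Nat.prime_dvd_prime_iff_eq hp hq).1 h).symm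
    exact hnd L (exists_definable_of_residue_not_pow p (hK L) hBtop hqL h)
  · by_contra! h
    exact hnd L (exists_definable_of_residue_not_artinSchreier p (hK L) hBtop h)

theorem mainTheorem1 (K : Type u) [Field K]
    (hK : ∀ (L : Type u) [Field L] [Algebra K L] [FiniteDimensional K L], FinitePowerIndices L) :
    (∃ (Γ₀ : Type u) (_ : LinearOrderedCommGroupWithZero Γ₀) (v : Valuation K Γ₀),
      Function.Surjective v ∧ v.IsNontrivial ∧ IsDefinableValuation v) ∨
    (∀ (Γ₀ : Type w) [LinearOrderedCommGroupWithZero Γ₀] (v : Valuation K Γ₀),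
      Function.Surjective v → v.IsNontrivial →
        (∀ n : ℕ, 0 < n → ∀ γ : Γ₀ˣ, ∃ δ : Γ₀ˣ, δ ^ n = γ) ∧
        (0 < ringChar K → IsAlgClosed (IsLocalRing.ResidueField v.valuationSubring))) := by
  refine or_iff_not_imp_left.2 fun hnd => ?_
  have hnd' : ∀ (L : Type u) [Field L] [Algebra K L] [FiniteDimensional K L],
      ¬ ∃ R : ValuationSubring L, R ≠ ⊤ ∧ CoordDefinableSet K (R : Set L) :=
    fun L _ _ _ h => hnd (exists_definable_valuation h)
  intro Γ₀ _ v hsurj hnt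
  have hA : v.valuationSubring ≠ ⊤ := fun h => v.valuationSubring_eq_top_iff.1 h hnt
  refine ⟨fun n hn γ => ?_, fun hchar => ?_⟩
  · by_contra! h
    obtain ⟨x, hx⟩ := hsurj γ
    have hx0 : x ≠ 0 := fun h => γ.ne_zero (by rw [← hx, h, map_zero])
    refine hnd' K (exists_definable_of_value_not_pow (hK K) v.valuationSubring hn hx0 fun y hy => ?_)
    have heq : v x = v y ^ n := by
      rw [← map_pow] at hy ⊢
      exact (v.isEquiv_valuation_valuationSubring.eq_iff).2 hy
    have hy0 : v y ≠ 0 := fun h => by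
      rw [h, zero_pow hn.ne', hx] at heq
      exact γ.ne_zero heq
    refine h (Units.mk0 (v y) hy0) (Units.ext ?_)
    rw [Units.val_pow_eq_pow_val, Units.val_mk0, ← heq, hx]
  · have : Fact (ringChar K).Prime :=
      ⟨(CharP.char_is_prime_or_zero K (ringChar K)).resolve_right hchar.ne'⟩
    exact isAlgClosed_residueField_of_not_definable hK hnd' (ringChar K) hA
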